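/- Let $K$ be a field. A *Lie algebra with grade* over $K$ is a Lie algebra $L=\bigoplus_{k\ge 1}L_k$ (no signs in the bracket) with $[L_k,L_l]\subseteq L_{k+l}$; its universal enveloping algebra $U(L)$ is graded by letting $U(L)_k$ be the span of the products $y_1\cdots y_r$ with $y_s\in L_{k_s}$ and $k_1+\dots+k_r=k$. Strongly free sets. Let $A=\bigoplus_{k\ge0}A_k$ be a connected graded associative $K$-algebra ($A_0=K$), and write $A^+=\bigoplus_{k\ge1}A_k$. Let $B\subseteq A$ be a graded subalgebra, put $B^+=B\cap A^+$ and let $\pi\colon A\to C:=A/AB^+A$ be the quotient map. For a degree-preserving linear section $\rho\colon C\to A$ of $\pi$, let $\mathrm{id}*\rho\colon B*C\to A$ be the linear map on the free product (coproduct) of $B$ and $C$ that sends $1$ to $1$ and every product of elements taken alternately from $B^+$ and $C^+=\pi(A^+)$ to the corresponding product in $A$, in the same order, with each factor $c\in C^+$ replaced by $\rho(c)$ and each factor in $B^+$ unchanged. $B$ is a *weak summand* of $A$ if $\mathrm{id}*\rho$ is bijective for some such $\rho$. Homogeneous elements $\alpha_1,\dots,\alpha_n\in A$ form a *strongly free set*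 in $A$ if the subalgebra $K\langle\alpha_1,\dots,\alpha_n\rangle$ that they generate is the free associative algebra on $\alpha_1,\dots,\alpha_n$ and is a weak summand of $A$. Elements of a Lie algebra with grade $F$ form a strongly free set in $F$ if their images in $U(F)$ form a strongly free set in $U(F)$. **Lemma.** Let $L=\bigoplus_{k\ge1}L_k$ be a Lie algebra with grade over $K$, generated by homogeneous elements $x_1,\dots,x_m$ with $x_i\in L_{d_i}$, $d_i\ge 1$. Let $F$ be the free Lie algebra on $m$ generators of degrees $d_1,\dots,d_m$, with the induced grading, and let $\alpha_1,\dots,\alpha_n\in F$ be homogeneous elements of degrees $e_1,\dots,e_n$ which are defining relations of $L$, i.e. the kernel of the homomorphism $F\to L$ sending the $i$-th generator to $x_i$ is the Lie ideal generated by $\alpha_1,\dots,\alpha_n$. If $\alpha_1,\dots,\alpha_n$ form a strongly free set in $F$, then all $L_k$ and all $U(L)_k$ are finite-dimensional and the Hilbert series of $U(L)$ satisfies $$\sum_{k\ge0}\dim U(L)_k\,q^k=\frac{1}{1-q^{d_1}-\dots-q^{d_m}+q^{e_1}+\dots+q^{e_n}}=\frac{1}{\prod_{k=1}^{\infty}(1-q^k)^{\dim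 L_k}}$$ in $\mathbb Z[[q]]$. -/

import Mathlib

open scoped PowerSeries PowerSeries.WithPiTopology

noncomputable section

namespace StronglyFreeLie

universe u v w

/-! ### Graded vector spaces and graded Lie algebras -/

/-- The Hilbert series `∑ dim (𝒜 k) q ^ k` of a graded vector space. It is meaningful when all
the components are finite-dimensional. -/
def hilbertSeries {K : Type u} [Field K] {A : Type v} [AddCommGroup A] [Module K A]
    (𝒜 : ℕ → Submodule K A) : ℤ⟦X⟧ :=
  PowerSeries.mk fun k => (Module.finrank K (𝒜 k) : ℤ)

/-- The subspace `⨁_{k ≥ 1} A_k` of a graded algebra (its augmentation ideal when the algebra is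
connected). -/
def positivePart {K : Type u} [Field K] {A : Type v} [AddCommGroup A] [Module K A]
    (𝒜 : ℕ → Submodule K A) : Submodule K A :=
  ⨆ k : ℕ, 𝒜 (k + 1)

/-- A Lie algebra with grade: `L = ⨁_{k ≥ 1} L_k` and `[L_k, L_l] ⊆ L_{k + l}`. -/
structure IsLieGrading {K : Type u} [Field K] {L : Type v} [LieRing L] [LieAlgebra K L]
    (ℒ : ℕ → Submodule K L) : Prop where
  isInternal : DirectSum.IsInternal ℒ
  zero_eq_bot : ℒ 0 = ⊥
  lie_mem : ∀ (k l : ℕ) (x y : L), x ∈ ℒ k → y ∈ ℒ l → ⁅x, y⁆ ∈ ℒ (k + l)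

/-- Homogeneous products in the universal enveloping algebra of a graded Lie algebra:
`IsEnvelopingMonomial ℒ k u` says that `u = x₁ x₂ ⋯ x_r` where each `x_s` is a homogeneous element
of the Lie algebra and the degrees add up to `k`. -/
inductive IsEnvelopingMonomial {K : Type u} [Field K] {L : Type v} [LieRing L] [LieAlgebra K L]
    (ℒ : ℕ → Submodule K L) : ℕ → UniversalEnvelopingAlgebra K L → Prop
  | one : IsEnvelopingMonomial ℒ 0 1
  | mul (k l : ℕ) (x : L) (u : UniversalEnvelopingAlgebra K L) :
      x ∈ ℒ k → IsEnvelopingMonomial ℒ l u →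
        IsEnvelopingMonomial ℒ (k + l) (UniversalEnvelopingAlgebra.ι K x * u)

/-- The grading of the universal enveloping algebra induced by a grading of the Lie algebra. -/
def envelopingGrading {K : Type u} [Field K] {L : Type v} [LieRing L] [LieAlgebra K L]
    (ℒ : ℕ → Submodule K L) (k : ℕ) : Submodule K (UniversalEnvelopingAlgebra K L) :=
  Submodule.span K {u | IsEnvelopingMonomial ℒ k u}

/-- Iterated brackets of generators in a free Lie algebra, with their degrees, when the generator
`i` is given the degree `d i`. -/
inductive IsLieMonomial (K : Type u) [Field K] {I : Type w} (d : I → ℕ) :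
    ℕ → FreeLieAlgebra K I → Prop
  | of (i : I) : IsLieMonomial K d (d i) (FreeLieAlgebra.of K i)
  | lie (k l : ℕ) (a b : FreeLieAlgebra K I) :
      IsLieMonomial K d k a → IsLieMonomial K d l b → IsLieMonomial K d (k + l) ⁅a, b⁆

/-- The grading of the free Lie algebra on generators of degrees `d i`. -/
def freeLieGrading (K : Type u) [Field K] {I : Type w} (d : I → ℕ) (k : ℕ) :
    Submodule K (FreeLieAlgebra K I) :=
  Submodule.span K {a | IsLieMonomial K d k a}

/-! ### The free product of two algebras -/

/-- The family consisting of two algebras. -/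
def Factor (B C : Type v) : Bool → Type v
  | false => B
  | true => C

instance Factor.ring (B C : Type v) [Ring B] [Ring C] : (i : Bool) → Ring (Factor B C i)
  | false => inferInstanceAs (Ring B)
  | true => inferInstanceAs (Ring C)

instance Factor.algebra (K : Type u) [Field K] (B C : Type v) [Ring B] [Ring C] [Algebra K B]
    [Algebra K C] : (i : Bool) → Algebra K (Factor B C i)
  | false => inferInstanceAs (Algebra K B)
  | true => inferInstanceAs (Algebra K C)

/-- The free product `B * C` of two associative unital algebras, i.e. their coproduct. -/
abbrev FreeProd (K : Type u) [Field K] (B C : Type v) [Ring B] [Ring C] [Algebra K B]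
    [Algebra K C] : Type _ :=
  LinearAlgebra.FreeProduct K (Factor B C)

/-- The canonical map `B → B * C`. -/
def FreeProd.inl (K : Type u) [Field K] (B C : Type v) [Ring B] [Ring C] [Algebra K B]
    [Algebra K C] : B →ₐ[K] FreeProd K B C :=
  LinearAlgebra.FreeProduct.ι K (Factor B C) false

/-- The canonical map `C → B * C`. -/
def FreeProd.inr (K : Type u) [Field K] (B C : Type v) [Ring B] [Ring C] [Algebra K B]
    [Algebra K C] : C →ₐ[K] FreeProd K B C :=
  LinearAlgebra.FreeProduct.ι K (Factor B C) true

/-- A word whose letters lie alternately in `B' ⊆ B` and `C' ⊆ C`. -/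
def IsAlternating {K : Type u} [Field K] {B C : Type v} [Ring B] [Ring C] [Algebra K B]
    [Algebra K C] (B' : Submodule K B) (C' : Submodule K C) (s : List (B ⊕ C)) : Prop :=
  s.IsChain (fun x y => x.isLeft ≠ y.isLeft) ∧
    (∀ b : B, Sum.inl b ∈ s → b ∈ B') ∧ (∀ c : C, Sum.inr c ∈ s → c ∈ C')

/-- `φ` is the linear map `f * g : B * C → A` determined by two linear maps `f : B → A` and
`g : C → A`. When `B'` and `C'` are the augmentation ideals, `B * C` is the direct sum of `K`
(spanned by the empty word) and of the alternating tensor products of `B'` and `C'`, and `f * g`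
sends the alternating word `b₁ c₁ b₂ ⋯` to `f b₁ * g c₁ * f b₂ * ⋯`. -/
def IsFreeProdMap {K : Type u} [Field K] {A : Type w} {B C : Type v} [Ring A] [Ring B] [Ring C]
    [Algebra K A] [Algebra K B] [Algebra K C] (B' : Submodule K B) (C' : Submodule K C)
    (f : B →ₗ[K] A) (g : C →ₗ[K] A) (φ : FreeProd K B C →ₗ[K] A) : Prop :=
  ∀ s : List (B ⊕ C), IsAlternating B' C' s →
    φ (s.map (Sum.elim (FreeProd.inl K B C) (FreeProd.inr K B C))).prod =
      (s.map (Sum.elim f g)).prod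

/-! ### Weak summands and strongly free sets -/

/-- The two-sided ideal of a graded algebra `A` that is generated by the elements of positive
degree of a subalgebra `B`. -/
def subalgebraIdeal {K : Type u} [Field K] {A : Type v} [Ring A] [Algebra K A]
    (𝒜 : ℕ → Submodule K A) (B : Subalgebra K A) : Ideal A :=
  (TwoSidedIdeal.span {b : A | b ∈ B ∧ b ∈ positivePart 𝒜}).asIdeal

instance subalgebraIdeal.isTwoSided {K : Type u} [Field K] {A : Type v} [Ring A] [Algebra K A]
    (𝒜 : ℕ → Submodule K A) (B : Subalgebra K A) : (subalgebraIdeal 𝒜 B).IsTwoSided :=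
  inferInstanceAs ((TwoSidedIdeal.span {b : A | b ∈ B ∧ b ∈ positivePart 𝒜}).asIdeal).IsTwoSided

/-- The quotient algebra of `A` by the ideal generated by the positive part of `B`. -/
abbrev SubalgebraQuotient {K : Type u} [Field K] {A : Type v} [Ring A] [Algebra K A]
    (𝒜 : ℕ → Submodule K A) (B : Subalgebra K A) : Type v :=
  A ⧸ subalgebraIdeal 𝒜 B

/-- The quotient homomorphism `π`. -/
def subalgebraQuotientMk {K : Type u} [Field K] {A : Type v} [Ring A] [Algebra K A]
    (𝒜 : ℕ → Submodule K A) (B : Subalgebra K A) : A →ₐ[K] SubalgebraQuotient 𝒜 B :=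
  Ideal.Quotient.mkₐ K (subalgebraIdeal 𝒜 B)

/-- A subalgebra `B` of a connected graded algebra `A` is a weak summand if, for a degree-preserving
linear section `ρ` of the quotient map `π : A → A / A B⁺ A`, the linear map
`id * ρ : B * (A / A B⁺ A) → A` is bijective. -/
def IsWeakSummand {K : Type u} [Field K] {A : Type v} [Ring A] [Algebra K A]
    (𝒜 : ℕ → Submodule K A) (B : Subalgebra K A) : Prop :=
  ∃ ρ : SubalgebraQuotient 𝒜 B →ₗ[K] A,
    (∀ c, subalgebraQuotientMk 𝒜 B (ρ c) = c) ∧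
    (∀ k, ∀ a ∈ 𝒜 k, ρ (subalgebraQuotientMk 𝒜 B a) ∈ 𝒜 k) ∧
    ∃ φ : FreeProd K B (SubalgebraQuotient 𝒜 B) →ₗ[K] A,
      IsFreeProdMap ((positivePart 𝒜).comap B.val.toLinearMap)
        ((positivePart 𝒜).map (subalgebraQuotientMk 𝒜 B).toLinearMap) B.val.toLinearMap ρ φ ∧
      Function.Bijective φ

/-- A family `α` of homogeneous elements of a connected graded algebra `A` is strongly free if the
subalgebra `K⟨α⟩` that it generates is free on `α` and is a weak summand of `A`. -/
def IsStronglyFree {K : Type u} [Field K] {A : Type v} [Ring A] [Algebra K A]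
    (𝒜 : ℕ → Submodule K A) {J : Type w} (α : J → A) : Prop :=
  (∀ j, ∃ k, α j ∈ 𝒜 k) ∧
    Function.Injective (FreeAlgebra.lift K α) ∧
      IsWeakSummand 𝒜 (Algebra.adjoin K (Set.range α))

/-- A family of elements of a graded Lie algebra is strongly free if its image in the universal
enveloping algebra is strongly free. -/
def IsLieStronglyFree {K : Type u} [Field K] {L : Type v} [LieRing L] [LieAlgebra K L]
    (ℒ : ℕ → Submodule K L) {J : Type w} (α : J → L) : Prop :=
  IsStronglyFree (envelopingGrading ℒ) fun j => UniversalEnvelopingAlgebra.ι K (α j)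

end StronglyFreeLie

end

/-! Write `A = U(F)`, `B` for the subalgebra generated by the `α j`, and `C = A / A B⁺ A`. Three
facts combine.

The algebra `A` is free associative, with the words in the generators as a basis. A word is empty or
a letter followed by a word, so `H_A (1 - ∑ q ^ d i) = 1` (`hilbertSeries_free_mul`). The quotient
`C` is `U(L)`, degree by degree, because killing the `α j` in `U(F)` amounts to passing to the
enveloping algebra of `F` modulo the ideal they generate (`finrank_map_subalgebraQuotientMk`).

Since `B` is free on the `α j`, splitting at the first occurrence of some `α j` gives `B * C = C ⊕ ⨁
j, C ⊗ α j ⊗ (B * C)` (`extMap_freeProd_bijective`). The bijection `id * ρ` carries this to `A =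
ρ(C) ⊕ ⨁ j, ρ(C) α j A` (`exists_extMap_bijective`). This works although `ρ` is only linear, because
the letters of `C` are always separated by an `α j`. Counting dimensions gives `H_A = H_C + (∑ q ^ e
j) H_C H_A` (`IsStronglyFree.hilbertSeries_eq`), and eliminating `H_A` yields the first formula.

The product formula is Poincaré–Birkhoff–Witt on the level of Hilbert series, proved without ordered
monomials. A nonzero `x` of minimal degree `d` has a homogeneous codimension-one ideal `I` as
complement, and `U(L) = U(I) ⊕ U(L) x`, so `H_U(L) (1 - q ^ d) = H_U(I)`
(`hilbertSeries_mul_one_sub_X_pow`). Modulo `q ^ (N + 1)` finitely many such steps suffice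
(`coeff_hilbertSeries_mul_prod`), and `hilbertSeries_mul_tprod` passes to the limit. -/

noncomputable section

namespace StronglyFreeLie

/-! ### Graded vector spaces -/

section Graded

variable {K : Type*} [Field K] {A : Type*} [AddCommGroup A] [Module K A]

/-- A spanning family of subspaces admitting projections is a direct sum decomposition. -/
theorem isInternal_of_projections {𝒜 : ℕ → Submodule K A} (p : ℕ → A →ₗ[K] A)
    (hp : ∀ k, ∀ a ∈ 𝒜 k, p k a = a) (hp' : ∀ j k, j ≠ k → ∀ a ∈ 𝒜 j, p k a = 0)
    (htop : ⨆ k, 𝒜 k = ⊤) : DirectSum.IsInternal 𝒜 := by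
  refine DirectSum.isInternal_submodule_of_iSupIndep_of_iSup_eq_top ?_ htop
  rw [iSupIndep_def]
  intro k
  rw [Submodule.disjoint_def]
  intro a ha ha'
  rw [← hp k a ha]
  have : ⨆ j, ⨆ (_ : j ≠ k), 𝒜 j ≤ LinearMap.ker (p k) :=
    iSup₂_le fun j hj b hb => hp' j k hj b hb
  exact this ha'

/-- The projections of a direct sum decomposition. -/
theorem exists_projections {𝒜 : ℕ → Submodule K A} (h : DirectSum.IsInternal 𝒜) :
    ∃ p : ℕ → A →ₗ[K] A, (∀ k a, p k a ∈ 𝒜 k) ∧ (∀ k, ∀ a ∈ 𝒜 k, p k a = a) ∧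
      (∀ j k, j ≠ k → ∀ a ∈ 𝒜 j, p k a = 0) := by
  let e := LinearEquiv.ofBijective (DirectSum.coeLinearMap 𝒜) h
  refine ⟨fun k => (𝒜 k).subtype ∘ₗ DirectSum.component K ℕ (fun i => 𝒜 i) k ∘ₗ e.symm.toLinearMap,
    fun k a => Submodule.coe_mem _, fun k a ha => ?_, fun j k hjk a ha => ?_⟩
  · exact congrArg Subtype.val (h.ofBijective_coeLinearMap_of_mem ha)
  · exact congrArg Subtype.val (h.ofBijective_coeLinearMap_of_mem_ne hjk ha)

/-- A spanning graded subfamily of a direct sum decomposition is the whole decomposition. -/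
theorem eq_of_le_of_iSup_eq_top {𝒜 𝒮 : ℕ → Submodule K A} (h : DirectSum.IsInternal 𝒜)
    (hle : ∀ k, 𝒮 k ≤ 𝒜 k) (htop : ⨆ k, 𝒮 k = ⊤) (k : ℕ) : 𝒮 k = 𝒜 k := by
  refine le_antisymm (hle k) fun a ha => ?_
  obtain ⟨p, -, hp, hp'⟩ := exists_projections h
  -- The projection `p k` fixes `𝒮 k` and kills the other `𝒮 j`, so it sends everything into `𝒮 k`;
  -- but it also fixes `a`.
  have hmap : ⨆ j, 𝒮 j ≤ (𝒮 k).comap (p k) := by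
    refine iSup_le fun j b hb => ?_
    rw [Submodule.mem_comap]
    by_cases hjk : j = k
    · subst hjk
      rwa [hp _ b (hle _ hb)]
    · rw [hp' j k hjk b (hle _ hb)]
      exact zero_mem _
  have := hmap (htop ▸ Submodule.mem_top : a ∈ ⨆ j, 𝒮 j)
  rwa [Submodule.mem_comap, hp k a ha] at this

end Graded

/-! ### Counting with weights -/

/-- The generating series of a weight function with finite fibres. -/
def weightSeries {ι : Type*} (w : ι → ℕ) : ℤ⟦X⟧ :=
  PowerSeries.mk fun k => (Nat.card {i // w i = k} : ℤ)

theorem weightSeries_congr {ι κ : Type*} (e : ι ≃ κ) {w : ι → ℕ} {v : κ → ℕ}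
    (h : ∀ i, v (e i) = w i) : weightSeries w = weightSeries v := by
  ext k
  simp only [weightSeries, PowerSeries.coeff_mk, Nat.cast_inj]
  exact Nat.card_congr (e.subtypeEquiv fun i => by rw [h])

theorem weightSeries_sum {ι κ : Type*} (w : ι → ℕ) (v : κ → ℕ)
    (hw : ∀ k, Finite {i // w i = k}) (hv : ∀ k, Finite {i // v i = k}) :
    weightSeries (Sum.elim w v) = weightSeries w + weightSeries v := by
  ext k
  simp only [weightSeries, PowerSeries.coeff_mk, map_add]
  rw [Nat.card_congr (Equiv.subtypeSum (p := fun s => Sum.elim w v s = k))]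
  have := hw k
  have := hv k
  simp [Nat.card_sum]

theorem weightSeries_unit : weightSeries (fun _ : Unit => 0) = 1 := by
  ext k
  simp only [weightSeries, PowerSeries.coeff_mk, PowerSeries.coeff_one]
  split_ifs with h
  · subst h; simp
  · have : IsEmpty {_i : Unit // 0 = k} := ⟨fun i => h i.2.symm⟩
    simp

theorem weightSeries_fintype {ι : Type*} [Fintype ι] (w : ι → ℕ) :
    weightSeries w = ∑ i, (PowerSeries.X : ℤ⟦X⟧) ^ w i := by
  classical
  ext k
  simp only [weightSeries, PowerSeries.coeff_mk, map_sum, PowerSeries.coeff_X_pow]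
  rw [Nat.card_eq_fintype_card, Fintype.card_subtype]
  simp [eq_comm, Finset.sum_boole]

/-- Pairs of given total weight, sorted by the weights of the components. -/
def fiberProdEquiv {ι κ : Type*} (w : ι → ℕ) (v : κ → ℕ) (k : ℕ) :
    {p : ι × κ // w p.1 + v p.2 = k} ≃
      Σ ab : (Finset.HasAntidiagonal.antidiagonal k : Finset (ℕ × ℕ)),
        {i // w i = ab.1.1} × {j // v j = ab.1.2} where
  toFun p := ⟨⟨(w p.1.1, v p.1.2), Finset.HasAntidiagonal.mem_antidiagonal.2 p.2⟩,
    ⟨p.1.1, rfl⟩, ⟨p.1.2, rfl⟩⟩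
  invFun q := ⟨(q.2.1.1, q.2.2.1), by
    rw [q.2.1.2, q.2.2.2]; exact Finset.HasAntidiagonal.mem_antidiagonal.1 q.1.2⟩
  left_inv p := rfl
  right_inv := by
    rintro ⟨⟨⟨a, b⟩, h⟩, ⟨i, hi⟩, ⟨j, hj⟩⟩
    have hi' : w i = a := hi
    have hj' : v j = b := hj
    subst hi' hj'
    rfl

theorem finite_fiber_prod {ι κ : Type*} {w : ι → ℕ} {v : κ → ℕ}
    (hw : ∀ k, Finite {i // w i = k}) (hv : ∀ k, Finite {i // v i = k}) (k : ℕ) :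
    Finite {p : ι × κ // w p.1 + v p.2 = k} :=
  Finite.of_equiv _ (fiberProdEquiv w v k).symm

theorem weightSeries_prod {ι κ : Type*} (w : ι → ℕ) (v : κ → ℕ)
    (hw : ∀ k, Finite {i // w i = k}) (hv : ∀ k, Finite {i // v i = k}) :
    weightSeries (fun p : ι × κ => w p.1 + v p.2) = weightSeries w * weightSeries v := by
  ext k
  simp only [weightSeries, PowerSeries.coeff_mk, PowerSeries.coeff_mul]
  rw [Nat.card_congr (fiberProdEquiv w v k), Nat.card_sigma]
  simp only [Nat.card_prod, Nat.cast_sum, Nat.cast_mul]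
  exact Finset.sum_coe_sort (Finset.HasAntidiagonal.antidiagonal k)
    (fun ab => (Nat.card {i // w i = ab.1} : ℤ) * (Nat.card {j // v j = ab.2} : ℤ))

section Basis

universe u v
variable {K : Type u} [Field K] {A : Type v} [AddCommGroup A] [Module K A]

theorem eq_span_of_homogeneous_basis {𝒜 : ℕ → Submodule K A} (h : DirectSum.IsInternal 𝒜)
    {ι : Type*} (b : Module.Basis ι K A) (w : ι → ℕ) (hb : ∀ i, b i ∈ 𝒜 (w i)) (k : ℕ) :
    Submodule.span K (Set.range fun i : {i // w i = k} => b i) = 𝒜 k := by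
  refine eq_of_le_of_iSup_eq_top h
    (𝒮 := fun k => Submodule.span K (Set.range fun i : {i // w i = k} => b i)) (fun k => ?_) ?_ k
  · rw [Submodule.span_le]
    rintro _ ⟨⟨i, rfl⟩, rfl⟩
    exact hb i
  · rw [eq_top_iff, ← b.span_eq, Submodule.span_le]
    rintro _ ⟨i, rfl⟩
    exact Submodule.mem_iSup_of_mem (w i) (Submodule.subset_span ⟨⟨i, rfl⟩, rfl⟩)

/-- The elements of degree `k` of a homogeneous basis form a basis of the component of
degree `k`. -/
def componentBasis {𝒜 : ℕ → Submodule K A} (h : DirectSum.IsInternal 𝒜)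
    {ι : Type*} (b : Module.Basis ι K A) (w : ι → ℕ) (hb : ∀ i, b i ∈ 𝒜 (w i)) (k : ℕ) :
    Module.Basis {i // w i = k} K (𝒜 k) :=
  (Module.Basis.span (b.linearIndependent.comp (Subtype.val : {i // w i = k} → ι)
    Subtype.val_injective)).map
      (LinearEquiv.ofEq _ _ (eq_span_of_homogeneous_basis h b w hb k))

theorem finite_fiber_of_homogeneous_basis {𝒜 : ℕ → Submodule K A} (h : DirectSum.IsInternal 𝒜)
    {ι : Type*} (b : Module.Basis ι K A) (w : ι → ℕ) (hb : ∀ i, b i ∈ 𝒜 (w i)) (k : ℕ)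
    [Module.Finite K (𝒜 k)] : Finite {i // w i = k} :=
  Module.Finite.finite_basis (componentBasis h b w hb k)

/-- The Hilbert series counts the elements of a homogeneous basis. -/
theorem hilbertSeries_eq_weightSeries {𝒜 : ℕ → Submodule K A} (h : DirectSum.IsInternal 𝒜)
    {ι : Type*} (b : Module.Basis ι K A) (w : ι → ℕ) (hb : ∀ i, b i ∈ 𝒜 (w i)) :
    hilbertSeries 𝒜 = weightSeries w := by
  ext k
  simp only [hilbertSeries, weightSeries, PowerSeries.coeff_mk]
  rw [Module.finrank_eq_nat_card_basis (componentBasis h b w hb k)]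

theorem exists_homogeneous_basis {𝒜 : ℕ → Submodule K A} (h : DirectSum.IsInternal 𝒜) :
    ∃ (ι : Type (max u v)) (b : Module.Basis ι K A) (w : ι → ℕ), ∀ i, b i ∈ 𝒜 (w i) :=
  ⟨_, (h.collectedBasis (α := fun k => Module.Free.ChooseBasisIndex K (𝒜 k))
    fun k => Module.Free.chooseBasis K (𝒜 k)).reindex Equiv.ulift.symm, fun i => i.down.1,
    fun i => by
      rw [Module.Basis.reindex_apply]
      exact h.collectedBasis_mem _ _⟩

end Basis

/-! ### Universal enveloping algebras -/

section Enveloping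

variable {K : Type*} [Field K] {L : Type*} [LieRing L] [LieAlgebra K L]

local notation "U" => UniversalEnvelopingAlgebra K L

/-- The canonical map of a Lie algebra to its enveloping algebra, as a linear map. -/
def envelopingι (K : Type*) [Field K] {L : Type*} [LieRing L] [LieAlgebra K L] :
    L →ₗ[K] UniversalEnvelopingAlgebra K L :=
  letI := LieRing.ofAssociativeRing (A := UniversalEnvelopingAlgebra K L)
  (UniversalEnvelopingAlgebra.ι K : L →ₗ⁅K⁆ UniversalEnvelopingAlgebra K L).toLinearMap

local notation "ι" => envelopingι K

theorem envelopingι_apply (x : L) : (ι x : U) = UniversalEnvelopingAlgebra.ι K x := rfl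

theorem envelopingι_lie (x y : L) : (ι ⁅x, y⁆ : U) = ι x * ι y - ι y * ι x := by
  let _ := LieRing.ofAssociativeRing (A := U)
  exact LieHom.map_lie (UniversalEnvelopingAlgebra.ι K : L →ₗ⁅K⁆ U) x y

/-- The homomorphism from the enveloping algebra induced by a linear map that sends brackets to
commutators. -/
def envelopingLift {A : Type*} [Ring A] [Algebra K A] (f : L →ₗ[K] A)
    (hf : ∀ x y, f ⁅x, y⁆ = f x * f y - f y * f x) : U →ₐ[K] A :=
  letI := LieRing.ofAssociativeRing (A := A)
  UniversalEnvelopingAlgebra.lift K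
    { toLinearMap := f
      map_lie' := fun {x y} => by
        rw [LieRing.of_associative_ring_bracket]
        exact hf x y }

@[simp] theorem envelopingLift_ι {A : Type*} [Ring A] [Algebra K A] (f : L →ₗ[K] A)
    (hf : ∀ x y, f ⁅x, y⁆ = f x * f y - f y * f x) (x : L) :
    envelopingLift f hf (ι x) = f x := by
  let _ := LieRing.ofAssociativeRing (A := A)
  exact UniversalEnvelopingAlgebra.lift_ι_apply K _ x

theorem enveloping_algHom_ext {A : Type*} [Ring A] [Algebra K A] {f g : U →ₐ[K] A}
    (h : ∀ x : L, f (ι x) = g (ι x)) : f = g := by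
  let _ := LieRing.ofAssociativeRing (A := A)
  exact UniversalEnvelopingAlgebra.hom_ext K (LieHom.ext h)

/-- By the universal property the canonical map, corestricted to the generated subalgebra, lifts to
`U`. Followed by the inclusion this lift is the identity, so the inclusion is onto. -/
theorem adjoin_range_envelopingι : Algebra.adjoin K (Set.range (ι : L → U)) = ⊤ := by
  set S := Algebra.adjoin K (Set.range (ι : L → U))
  let f : L →ₗ[K] S :=
    (ι).codRestrict (Subalgebra.toSubmodule S) fun x => Algebra.subset_adjoin ⟨x, rfl⟩
  let g := envelopingLift f fun x y => Subtype.ext (envelopingι_lie x y)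
  have hg : S.val.comp g = AlgHom.id K U := enveloping_algHom_ext fun x => by
    change S.val (g (ι x)) = _
    rw [envelopingLift_ι]
    rfl
  rw [eq_top_iff]
  intro u _
  rw [show u = S.val (g u) from (DFunLike.congr_fun hg u).symm]
  exact (g u).2

/-- A subspace that contains `1` and is stable under left multiplication by the elements of the
Lie algebra is everything. -/
theorem enveloping_submodule_eq_top {S : Submodule K U} (h1 : 1 ∈ S)
    (hmul : ∀ (x : L), ∀ u ∈ S, (ι x : U) * u ∈ S) : S = ⊤ := by
  have key : ∀ v : U, ∀ u ∈ S, v * u ∈ S := by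
    intro v
    have hv : v ∈ Algebra.adjoin K (Set.range (ι : L → U)) := by
      rw [adjoin_range_envelopingι]
      exact Algebra.mem_top
    induction hv using Algebra.adjoin_induction with
    | mem v hv => obtain ⟨x, rfl⟩ := hv; exact hmul x
    | algebraMap c =>
      intro u hu
      rw [← Algebra.smul_def]
      exact S.smul_mem c hu
    | add v w _ _ hv hw =>
      intro u hu
      rw [add_mul]
      exact add_mem (hv u hu) (hw u hu)
    | mul v w _ _ hv hw =>
      intro u hu
      rw [mul_assoc]
      exact hv _ (hw u hu)
  rw [eq_top_iff]
  intro v _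
  simpa using key v 1 h1

variable {ℒ : ℕ → Submodule K L}

theorem one_mem_envelopingGrading : (1 : U) ∈ envelopingGrading ℒ 0 :=
  Submodule.subset_span .one

theorem ι_mul_mem_envelopingGrading {k l : ℕ} {x : L} (hx : x ∈ ℒ k) {u : U}
    (hu : u ∈ envelopingGrading ℒ l) : ι x * u ∈ envelopingGrading ℒ (k + l) := by
  have : envelopingGrading ℒ l ≤
      (envelopingGrading ℒ (k + l)).comap (LinearMap.mulLeft K (ι x)) := by
    refine Submodule.span_le.2 fun u hu => ?_
    exact Submodule.subset_span (.mul k l x u hx hu)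
  exact this hu

theorem ι_mem_envelopingGrading {k : ℕ} {x : L} (hx : x ∈ ℒ k) :
    (ι x : U) ∈ envelopingGrading ℒ k := by
  simpa using ι_mul_mem_envelopingGrading hx (one_mem_envelopingGrading (ℒ := ℒ))

theorem mul_mem_envelopingGrading {k l : ℕ} {u v : U} (hu : u ∈ envelopingGrading ℒ k)
    (hv : v ∈ envelopingGrading ℒ l) : u * v ∈ envelopingGrading ℒ (k + l) := by
  have : envelopingGrading ℒ k ≤
      (envelopingGrading ℒ (k + l)).comap (LinearMap.mulRight K v) := by
    refine Submodule.span_le.2 fun u hu => ?_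
    clear * - hu hv
    induction hu with
    | one => simpa using hv
    | mul a b x u hx _ ih =>
      have ih' : u * v ∈ envelopingGrading ℒ (b + l) := ih
      change ι x * u * v ∈ envelopingGrading ℒ (a + b + l)
      rw [mul_assoc, add_assoc]
      exact ι_mul_mem_envelopingGrading hx ih'
  exact this hu

/-- To contain a component of the enveloping algebra it is enough to contain the unit (in degree
zero) and the products of homogeneous elements of the Lie algebra with lower components. -/
theorem envelopingGrading_le {S : ℕ → Submodule K U} (h1 : (1 : U) ∈ S 0)
    (hmul : ∀ k l, ∀ x ∈ ℒ k, ∀ u ∈ S l, ι x * u ∈ S (k + l)) (k : ℕ) :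
    envelopingGrading ℒ k ≤ S k := by
  refine Submodule.span_le.2 fun u hu => ?_
  induction hu with
  | one => exact h1
  | mul a b x u hx _ ih => exact hmul a b x hx u ih

theorem iSup_envelopingGrading (h : ⨆ k, ℒ k = ⊤) :
    ⨆ k, envelopingGrading ℒ k = (⊤ : Submodule K U) := by
  refine enveloping_submodule_eq_top
    (Submodule.mem_iSup_of_mem 0 one_mem_envelopingGrading) fun x u hu => ?_
  have hx : x ∈ ⨆ k, ℒ k := h ▸ Submodule.mem_top
  induction hx using Submodule.iSup_induction' with
  | zero => simp
  | add x y _ _ hx hy => rw [map_add, add_mul]; exact add_mem hx hy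
  | mem k x hx =>
    induction hu using Submodule.iSup_induction' with
    | zero => simp
    | add u v _ _ hu hv => rw [mul_add]; exact add_mem hu hv
    | mem l u hu => exact Submodule.mem_iSup_of_mem _ (ι_mul_mem_envelopingGrading hx hu)

theorem envelopingGrading_zero (h : ℒ 0 = ⊥) :
    envelopingGrading ℒ 0 = Submodule.span K {(1 : U)} := by
  refine le_antisymm ?_ (by simpa [Submodule.span_le] using one_mem_envelopingGrading)
  -- Only degree zero is constrained. A product of degree zero has both degrees zero, and its Lie
  -- factor then vanishes.
  refine envelopingGrading_le (S := fun k => if k = 0 then Submodule.span K {(1 : U)} else ⊤)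
    (by simp [Submodule.mem_span_singleton_self]) (fun k l x hx u hu => ?_) 0
  split_ifs with hkl
  · obtain ⟨rfl, rfl⟩ : k = 0 ∧ l = 0 := by omega
    rw [h, Submodule.mem_bot] at hx
    simp [hx]
  · trivial

/-- The components of the enveloping algebra are finite-dimensional if those of the Lie algebra
are. -/
theorem finite_envelopingGrading (h0 : ℒ 0 = ⊥) (hfin : ∀ k, Module.Finite K (ℒ k)) (k : ℕ) :
    Module.Finite K (envelopingGrading ℒ k) := by
  induction k using Nat.strong_induction_on with
  | _ k ih =>
    rcases Nat.eq_zero_or_pos k with rfl | hk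
    · rw [envelopingGrading_zero h0]
      infer_instance
    -- In degree `k > 0` everything comes from products `L_{k-l} U_l` with `l < k`: a leading factor
    -- of degree zero vanishes, so the remaining factor has smaller degree and the induction
    -- hypothesis applies.
    let T : Submodule K U := ⨆ l : Fin k,
      Submodule.map₂ (LinearMap.mul K U) ((ℒ (k - l)).map ι) (envelopingGrading ℒ l)
    have hTfin : Module.Finite K T := by
      have (l : Fin k) : Module.Finite K (Submodule.map₂ (LinearMap.mul K U)
          ((ℒ (k - l)).map ι) (envelopingGrading ℒ l)) :=
        have := ih l l.2
        Module.Finite.iff_fg.2 (.map₂ _ (Module.Finite.iff_fg.1 inferInstance)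
          (Module.Finite.iff_fg.1 inferInstance))
      exact Submodule.finite_iSup _
    have hT : T ≤ envelopingGrading ℒ k := by
      refine iSup_le fun l => Submodule.map₂_le.2 ?_
      rintro _ ⟨x, hx, rfl⟩ u hu
      have := ι_mul_mem_envelopingGrading hx hu
      rwa [Nat.sub_add_cancel l.2.le] at this
    have hle : envelopingGrading ℒ k ≤ T := by
      have := envelopingGrading_le (ℒ := ℒ)
        (S := fun j => if j = k then T else envelopingGrading ℒ j) ?_ ?_ k
      · simpa using this
      · rw [if_neg hk.ne]
        exact one_mem_envelopingGrading
      · intro a l x hx u hu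
        have hu' : u ∈ envelopingGrading ℒ l := by
          split_ifs at hu with hl
          · exact hl ▸ hT hu
          · exact hu
        split_ifs with hal
        · rcases Nat.eq_zero_or_pos a with rfl | ha
          · rw [h0, Submodule.mem_bot] at hx
            simp [hx]
          · refine Submodule.mem_iSup_of_mem ⟨l, by omega⟩ ?_
            refine Submodule.apply_mem_map₂ (LinearMap.mul K U) ⟨x, ?_, rfl⟩ hu'
            rwa [show k - l = a by omega]
        · exact ι_mul_mem_envelopingGrading hx hu'
    exact Submodule.finiteDimensional_of_le hle

/-- The homomorphism of enveloping algebras induced by a homomorphism of Lie algebras. -/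
def envelopingMap {L' : Type*} [LieRing L'] [LieAlgebra K L'] (f : L →ₗ⁅K⁆ L') :
    U →ₐ[K] UniversalEnvelopingAlgebra K L' :=
  envelopingLift (envelopingι K ∘ₗ f.toLinearMap) fun x y => by simp [envelopingι_lie]

@[simp] theorem envelopingMap_ι {L' : Type*} [LieRing L'] [LieAlgebra K L'] (f : L →ₗ⁅K⁆ L')
    (x : L) : envelopingMap f (ι x) = envelopingι K (f x) :=
  envelopingLift_ι _ _ x

end Enveloping

/-! ### The grading of a free Lie algebra -/

section FreeLie

variable {K : Type*} [Field K] {I : Type*} {d : I → ℕ}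

theorem of_mem_freeLieGrading (i : I) : FreeLieAlgebra.of K i ∈ freeLieGrading K d (d i) :=
  Submodule.subset_span (.of i)

theorem lie_mem_freeLieGrading {k l : ℕ} {a b : FreeLieAlgebra K I}
    (ha : a ∈ freeLieGrading K d k) (hb : b ∈ freeLieGrading K d l) :
    ⁅a, b⁆ ∈ freeLieGrading K d (k + l) := by
  induction ha using Submodule.span_induction with
  | zero => simp
  | add a a' _ _ h h' => rw [add_lie]; exact add_mem h h'
  | smul c a _ h => rw [smul_lie]; exact Submodule.smul_mem _ c h
  | mem a ha =>
    induction hb using Submodule.span_induction with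
    | zero => simp
    | add b b' _ _ h h' => rw [lie_add]; exact add_mem h h'
    | smul c b _ h => rw [lie_smul]; exact Submodule.smul_mem _ c h
    | mem b hb => exact Submodule.subset_span (.lie k l a b ha hb)

theorem IsLieMonomial.pos (hd : ∀ i, 1 ≤ d i) {k : ℕ} {a : FreeLieAlgebra K I}
    (h : IsLieMonomial K d k a) : 1 ≤ k := by
  induction h with
  | of i => exact hd i
  | lie k l a b _ _ hk _ => omega

theorem freeLieGrading_zero (hd : ∀ i, 1 ≤ d i) : freeLieGrading K d 0 = ⊥ := by
  refine (Submodule.span_eq_bot).2 fun a ha => ?_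
  have := IsLieMonomial.pos hd ha
  omega

theorem lieSpan_range_of :
    LieSubalgebra.lieSpan K (FreeLieAlgebra K I) (Set.range (FreeLieAlgebra.of K)) = ⊤ := by
  set S := LieSubalgebra.lieSpan K (FreeLieAlgebra K I) (Set.range (FreeLieAlgebra.of K))
  let g : FreeLieAlgebra K I →ₗ⁅K⁆ S := FreeLieAlgebra.lift K fun i =>
    ⟨FreeLieAlgebra.of K i, LieSubalgebra.subset_lieSpan ⟨i, rfl⟩⟩
  have hg : S.incl.comp g = LieHom.id := FreeLieAlgebra.hom_ext fun i => by simp [g]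
  rw [eq_top_iff]
  intro a _
  rw [show a = S.incl (g a) from (DFunLike.congr_fun hg a).symm]
  exact (g a).2

theorem iSup_freeLieGrading : ⨆ k, freeLieGrading K d k = ⊤ := by
  have key : ∀ a ∈ ⨆ k, freeLieGrading K d k, ∀ b ∈ ⨆ k, freeLieGrading K d k,
      ⁅a, b⁆ ∈ ⨆ k, freeLieGrading K d k := by
    intro a ha b hb
    induction ha using Submodule.iSup_induction' with
    | zero => simp
    | add a a' _ _ h h' => rw [add_lie]; exact add_mem h h'
    | mem k a ha =>
      induction hb using Submodule.iSup_induction' with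
      | zero => simp
      | add b b' _ _ h h' => rw [lie_add]; exact add_mem h h'
      | mem l b hb => exact Submodule.mem_iSup_of_mem _ (lie_mem_freeLieGrading ha hb)
  let S : LieSubalgebra K (FreeLieAlgebra K I) :=
    { toSubmodule := ⨆ k, freeLieGrading K d k
      lie_mem' := fun ha hb => key _ ha _ hb }
  have hS : LieSubalgebra.lieSpan K (FreeLieAlgebra K I) (Set.range (FreeLieAlgebra.of K)) ≤ S := by
    refine LieSubalgebra.lieSpan_le.2 ?_
    rintro _ ⟨i, rfl⟩
    exact Submodule.mem_iSup_of_mem (d i) (of_mem_freeLieGrading i)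
  rw [lieSpan_range_of] at hS
  exact eq_top_iff.2 fun a _ => hS (LieSubalgebra.mem_top a)

theorem finite_freeLieGrading [Finite I] (hd : ∀ i, 1 ≤ d i) (k : ℕ) :
    Module.Finite K (freeLieGrading K d k) := by
  induction k using Nat.strong_induction_on with
  | _ k ih =>
    let B : FreeLieAlgebra K I →ₗ[K] FreeLieAlgebra K I →ₗ[K] FreeLieAlgebra K I :=
      LinearMap.mk₂ K (fun a b => ⁅a, b⁆) add_lie smul_lie lie_add fun c a b => lie_smul c a b
    -- All generators are included, whatever their degrees; there are only finitely many. A bracket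
    -- monomial of degree `k` has both factors of degree less than `k`, since degrees are positive.
    let T : Submodule K (FreeLieAlgebra K I) := Submodule.span K (Set.range (FreeLieAlgebra.of K)) ⊔
      ⨆ p : Fin k × Fin k, Submodule.map₂ B (freeLieGrading K d p.1) (freeLieGrading K d p.2)
    have hTfin : Module.Finite K T := by
      have (p : Fin k × Fin k) : Module.Finite K
          (Submodule.map₂ B (freeLieGrading K d p.1) (freeLieGrading K d p.2)) :=
        have := ih p.1 p.1.2
        have := ih p.2 p.2.2
        Module.Finite.iff_fg.2 (.map₂ _ (Module.Finite.iff_fg.1 inferInstance)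
          (Module.Finite.iff_fg.1 inferInstance))
      have h1 := Submodule.finite_iSup fun p : Fin k × Fin k =>
        Submodule.map₂ B (freeLieGrading K d p.1) (freeLieGrading K d p.2)
      have h2 : Module.Finite K (Submodule.span K (Set.range (FreeLieAlgebra.of K (X := I)))) :=
        Module.Finite.span_of_finite K (Set.finite_range _)
      exact Submodule.finite_sup _ _
    have hle : freeLieGrading K d k ≤ T := by
      refine Submodule.span_le.2 fun a ha => ?_
      obtain i | ⟨k, l, a, b, ha, hb⟩ := ha
      · exact Submodule.mem_sup_left (Submodule.subset_span ⟨i, rfl⟩)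
      · have hk := IsLieMonomial.pos hd ha
        have hl := IsLieMonomial.pos hd hb
        exact Submodule.mem_sup_right (Submodule.mem_iSup_of_mem
          (⟨k, by omega⟩, ⟨l, by omega⟩)
          (Submodule.apply_mem_map₂ B (Submodule.subset_span ha) (Submodule.subset_span hb)))
    exact Submodule.finiteDimensional_of_le hle

/-- The linear map underlying the homomorphism from a free Lie algebra to the commutator Lie
algebra of an associative algebra with given values on the generators. -/
def freeLieLift {A : Type*} [Ring A] [Algebra K A] (f : I → A) : FreeLieAlgebra K I →ₗ[K] A :=
  letI := LieRing.ofAssociativeRing (A := A)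
  (FreeLieAlgebra.lift K f).toLinearMap

theorem freeLieLift_of {A : Type*} [Ring A] [Algebra K A] (f : I → A) (i : I) :
    freeLieLift f (FreeLieAlgebra.of K i) = f i := by
  let _ := LieRing.ofAssociativeRing (A := A)
  exact FreeLieAlgebra.lift_of_apply f i

theorem freeLieLift_lie {A : Type*} [Ring A] [Algebra K A] (f : I → A)
    (a b : FreeLieAlgebra K I) :
    freeLieLift f ⁅a, b⁆ =
      freeLieLift f a * freeLieLift f b - freeLieLift f b * freeLieLift f a := by
  let _ := LieRing.ofAssociativeRing (A := A)
  exact LieHom.map_lie (FreeLieAlgebra.lift K f) a b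

local notation "U" => UniversalEnvelopingAlgebra K (FreeLieAlgebra K I)

/-- The homomorphism `U → U[t]` that multiplies the elements of degree `k` by `t ^ k`. -/
def gradingCoaction (d : I → ℕ) : U →ₐ[K] Polynomial U :=
  envelopingLift
    (freeLieLift fun i => Polynomial.monomial (d i) (envelopingι K (FreeLieAlgebra.of K i)))
    (freeLieLift_lie _)

theorem gradingCoaction_apply {k : ℕ} {u : U}
    (hu : u ∈ envelopingGrading (freeLieGrading K d) k) :
    gradingCoaction d u = Polynomial.monomial k u := by
  have hF (k : ℕ) (a) (ha : a ∈ freeLieGrading K d k) :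
      gradingCoaction d (envelopingι K a) = Polynomial.monomial k (envelopingι K a) := by
    rw [gradingCoaction, envelopingLift_ι]
    induction ha using Submodule.span_induction with
    | zero => simp
    | add a b _ _ ha hb => simp [ha, hb]
    | smul c a _ ha => rw [map_smul, ha, map_smul, Polynomial.smul_monomial]
    | mem a ha =>
      induction ha with
      | of i => exact freeLieLift_of _ i
      | lie k l a b _ _ ha hb =>
        rw [freeLieLift_lie, ha, hb, Polynomial.monomial_mul_monomial,
          Polynomial.monomial_mul_monomial, envelopingι_lie, map_sub, add_comm l k]
  induction hu using Submodule.span_induction with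
  | zero => simp
  | add a b _ _ ha hb => simp [ha, hb]
  | smul c a _ ha => rw [map_smul, ha, Polynomial.smul_monomial]
  | mem a ha =>
    induction ha with
    | one => simp
    | mul k l x u hx _ ih =>
      rw [← envelopingι_apply, map_mul, ih, hF k x hx, Polynomial.monomial_mul_monomial]

/-- The coefficient of `t ^ k` in the coaction `U → U[t]` is a projection onto degree `k`.
Directness of the grading of the free Lie algebra itself is not needed for this. -/
theorem isInternal_envelopingGrading_freeLieGrading (d : I → ℕ) :
    DirectSum.IsInternal (envelopingGrading (freeLieGrading K d)) := by
  refine isInternal_of_projections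
    (fun k => (Polynomial.lcoeff U k).restrictScalars K ∘ₗ (gradingCoaction d).toLinearMap)
    (fun k a ha => ?_) (fun j k hjk a ha => ?_) (iSup_envelopingGrading iSup_freeLieGrading)
  · change (gradingCoaction d a).coeff k = a
    rw [gradingCoaction_apply ha, Polynomial.coeff_monomial_same]
  · change (gradingCoaction d a).coeff k = 0
    rw [gradingCoaction_apply ha, Polynomial.coeff_monomial, if_neg hjk]

/-- The basis of the enveloping algebra of a free Lie algebra that consists of the words in the
generators. -/
def wordBasis (K : Type*) [Field K] (I : Type*) : Module.Basis (List I) K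
    (UniversalEnvelopingAlgebra K (FreeLieAlgebra K I)) :=
  ((FreeAlgebra.basisFreeMonoid K I).reindex FreeMonoid.toList).map
    (FreeLieAlgebra.universalEnvelopingEquivFreeAlgebra K I).symm.toLinearEquiv

theorem wordBasis_apply (w : List I) :
    wordBasis K I w = (w.map fun i => envelopingι K (FreeLieAlgebra.of K i)).prod := by
  have h : FreeAlgebra.basisFreeMonoid K I (FreeMonoid.ofList w) =
      (w.map (FreeAlgebra.ι K)).prod := by
    simp [FreeAlgebra.basisFreeMonoid, FreeAlgebra.equivMonoidAlgebraFreeMonoid]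
  have hsymm (i : I) : (FreeLieAlgebra.universalEnvelopingEquivFreeAlgebra K I).symm
      (FreeAlgebra.ι K i) = envelopingι K (FreeLieAlgebra.of K i) :=
    FreeAlgebra.lift_ι_apply _ _
  rw [wordBasis, Module.Basis.map_apply, Module.Basis.reindex_apply]
  change (FreeLieAlgebra.universalEnvelopingEquivFreeAlgebra K I).symm
    (FreeAlgebra.basisFreeMonoid K I (FreeMonoid.ofList w)) = _
  rw [h, map_list_prod, List.map_map]
  congr 2
  funext i
  exact hsymm i

theorem wordBasis_mem (w : List I) :
    wordBasis K I w ∈ envelopingGrading (freeLieGrading K d) (w.map d).sum := by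
  rw [wordBasis_apply]
  induction w with
  | nil => simpa using one_mem_envelopingGrading
  | cons i w ih =>
    simp only [List.map_cons, List.prod_cons, List.sum_cons]
    exact ι_mul_mem_envelopingGrading (of_mem_freeLieGrading i) ih

/-- The Hilbert series of a free associative algebra. -/
theorem hilbertSeries_free_mul [Fintype I] (hd : ∀ i, 1 ≤ d i) :
    hilbertSeries (envelopingGrading (freeLieGrading K d)) *
      (1 - ∑ i, (PowerSeries.X : ℤ⟦X⟧) ^ d i) = 1 := by
  have hint := isInternal_envelopingGrading_freeLieGrading (K := K) d
  have hfin (k : ℕ) : Module.Finite K (envelopingGrading (freeLieGrading K d) k) :=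
    finite_envelopingGrading (freeLieGrading_zero hd) (fun k => finite_freeLieGrading hd k) k
  rw [hilbertSeries_eq_weightSeries hint (wordBasis K I) (fun w => (w.map d).sum) wordBasis_mem]
  have hfib (k : ℕ) := finite_fiber_of_homogeneous_basis hint (wordBasis K I)
    (fun w => (w.map d).sum) wordBasis_mem k
  -- Removing the first letter of a word turns the count into `H = 1 + (∑ q ^ d i) H`.
  let e : List I ≃ Unit ⊕ I × List I :=
    { toFun := fun w => match w with
        | [] => Sum.inl ()
        | i :: w => Sum.inr (i, w)
      invFun := Sum.elim (fun _ => []) fun p => p.1 :: p.2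
      left_inv := by rintro (_ | _) <;> rfl
      right_inv := by rintro (_ | _) <;> rfl }
  have h := weightSeries_congr e (w := fun w => (w.map d).sum)
    (v := Sum.elim (fun _ => 0) fun p => d p.1 + (p.2.map d).sum) (by rintro (_ | _) <;> simp [e])
  rw [weightSeries_sum _ _ (fun k => inferInstance)
    (finite_fiber_prod (fun k => inferInstance) hfib), weightSeries_unit,
    weightSeries_prod _ _ (fun k => inferInstance) hfib, weightSeries_fintype d] at h
  linear_combination h

end FreeLie

/-! ### Presentations of graded Lie algebras -/

section Presentation

variable {K : Type*} [Field K] {L : Type*} [LieRing L] [LieAlgebra K L]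

/-- The augmentation of an enveloping algebra. -/
def envelopingCounit (K : Type*) [Field K] (L : Type*) [LieRing L] [LieAlgebra K L] :
    UniversalEnvelopingAlgebra K L →ₐ[K] K :=
  envelopingLift 0 fun x y => by simp

@[simp] theorem envelopingCounit_ι (x : L) : envelopingCounit K L (envelopingι K x) = 0 :=
  envelopingLift_ι _ _ x

theorem envelopingCounit_of_mem_positivePart {ℒ : ℕ → Submodule K L}
    {u : UniversalEnvelopingAlgebra K L} (hu : u ∈ positivePart (envelopingGrading ℒ)) :
    envelopingCounit K L u = 0 := by
  have : positivePart (envelopingGrading ℒ) ≤ LinearMap.ker (envelopingCounit K L).toLinearMap := by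
    refine iSup_le fun k => ?_
    -- Degree zero is filled with `⊤` because the unit is not in the kernel; any other product with
    -- a Lie element on the left is killed by multiplicativity.
    simpa using envelopingGrading_le (ℒ := ℒ)
      (S := fun k => if k = 0 then ⊤ else LinearMap.ker (envelopingCounit K L).toLinearMap)
      (by simp) (fun k l x hx u hu => by split_ifs <;> simp) (k + 1)
  exact this hu

variable {I : Type*} {d : I → ℕ} {ℒ : ℕ → Submodule K L} {x : I → L}

theorem freeLieAlgebra_lift_surjective (hgen : LieSubalgebra.lieSpan K L (Set.range x) = ⊤) :
    Function.Surjective (FreeLieAlgebra.lift K x) := by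
  have h : LieSubalgebra.lieSpan K L (Set.range x) ≤ (FreeLieAlgebra.lift K x).range := by
    refine LieSubalgebra.lieSpan_le.2 ?_
    rintro _ ⟨i, rfl⟩
    exact ⟨FreeLieAlgebra.of K i, FreeLieAlgebra.lift_of_apply x i⟩
  rw [hgen] at h
  exact fun y => h (LieSubalgebra.mem_top y)

/-- The images lie in the right degrees and together span `L`, so directness of the grading of `L`
forces equality. Finiteness of the components of `F` thereby descends to `L`. -/
theorem map_freeLieGrading (hℒ : IsLieGrading ℒ) (hx : ∀ i, x i ∈ ℒ (d i))
    (hgen : LieSubalgebra.lieSpan K L (Set.range x) = ⊤) (k : ℕ) :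
    (freeLieGrading K d k).map (FreeLieAlgebra.lift K x).toLinearMap = ℒ k := by
  refine eq_of_le_of_iSup_eq_top hℒ.isInternal (𝒮 := fun k =>
    (freeLieGrading K d k).map (FreeLieAlgebra.lift K x).toLinearMap) (fun k => ?_) ?_ k
  · refine Submodule.map_le_iff_le_comap.2 (Submodule.span_le.2 fun a ha => ?_)
    change FreeLieAlgebra.lift K x a ∈ ℒ k
    induction ha with
    | of i => rw [FreeLieAlgebra.lift_of_apply]; exact hx i
    | lie k l a b _ _ ha hb => rw [LieHom.map_lie]; exact hℒ.lie_mem k l _ _ ha hb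
  · rw [← Submodule.map_iSup, iSup_freeLieGrading, Submodule.map_top]
    exact LinearMap.range_eq_top.2 (freeLieAlgebra_lift_surjective hgen)

theorem map_envelopingGrading {L' : Type*} [LieRing L'] [LieAlgebra K L'] (f : L →ₗ⁅K⁆ L')
    {ℒ' : ℕ → Submodule K L'} (hf : ∀ k, (ℒ k).map f.toLinearMap = ℒ' k) (k : ℕ) :
    (envelopingGrading ℒ k).map (envelopingMap f).toLinearMap = envelopingGrading ℒ' k := by
  refine le_antisymm (Submodule.map_le_iff_le_comap.2 (envelopingGrading_le
    (S := fun k => (envelopingGrading ℒ' k).comap (envelopingMap f).toLinearMap) ?_ ?_ k))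
    (envelopingGrading_le (S := fun k => (envelopingGrading ℒ k).map
      (envelopingMap f).toLinearMap) ⟨1, one_mem_envelopingGrading, map_one (envelopingMap f)⟩ ?_ k)
  · simpa using one_mem_envelopingGrading
  · intro k l y hy u hu
    change envelopingMap f (envelopingι K y * u) ∈ envelopingGrading ℒ' (k + l)
    rw [map_mul, envelopingMap_ι]
    exact ι_mul_mem_envelopingGrading (hf k ▸ ⟨y, hy, rfl⟩) hu
  · intro k l y hy u hu
    rw [← hf k] at hy
    obtain ⟨y, hy, rfl⟩ := hy
    obtain ⟨u, hu, rfl⟩ := hu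
    refine ⟨envelopingι K y * u, ι_mul_mem_envelopingGrading hy hu, ?_⟩
    change envelopingMap f (envelopingι K y * u) = _
    rw [map_mul, envelopingMap_ι]
    rfl

theorem envelopingMap_surjective {L' : Type*} [LieRing L'] [LieAlgebra K L'] {f : L →ₗ⁅K⁆ L'}
    (hf : Function.Surjective f) : Function.Surjective (envelopingMap f) := by
  rw [← AlgHom.range_eq_top, eq_top_iff, ← adjoin_range_envelopingι, Algebra.adjoin_le_iff]
  rintro _ ⟨y, rfl⟩
  obtain ⟨a, rfl⟩ := hf y
  exact ⟨envelopingι K a, envelopingMap_ι f a⟩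

/-- An algebra homomorphism from `U(L)` that kills generators of the kernel of a surjection
`L → L'` factors through `U(L')`. -/
theorem exists_comp_envelopingMap {L' : Type*} [LieRing L'] [LieAlgebra K L'] {f : L →ₗ⁅K⁆ L'}
    (hf : Function.Surjective f) {J : Type*} {α : J → L}
    (hker : f.ker = LieSubmodule.lieSpan K L (Set.range α)) {A : Type*} [Ring A] [Algebra K A]
    (π : UniversalEnvelopingAlgebra K L →ₐ[K] A) (hπ : ∀ j, π (envelopingι K (α j)) = 0) :
    ∃ g : UniversalEnvelopingAlgebra K L' →ₐ[K] A, g.comp (envelopingMap f) = π := by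
  -- The elements of the Lie algebra killed by `π` form a Lie ideal, since a bracket becomes a
  -- commutator.
  have hkill : ∀ a, f a = 0 → π (envelopingι K a) = 0 := by
    intro a ha
    replace ha : a ∈ LieSubmodule.lieSpan K L (Set.range α) := hker ▸ LieHom.mem_ker.2 ha
    induction ha using LieSubmodule.lieSpan_induction with
    | mem a ha => obtain ⟨j, rfl⟩ := ha; exact hπ j
    | zero => simp
    | add a b _ _ ha hb => simp [ha, hb]
    | smul c a _ ha => simp [ha]
    | lie b a _ ha => simp [envelopingι_lie, ha]
  -- A linear section suffices: by `hkill`, the value of `π` does not depend on the chosen lift, so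
  -- `h` respects brackets.
  obtain ⟨s, hs⟩ := f.toLinearMap.exists_rightInverse_of_surjective (LinearMap.range_eq_top.2 hf)
  have hs' (y : L') : f (s y) = y := LinearMap.congr_fun hs y
  let h : L' →ₗ[K] A := π.toLinearMap ∘ₗ envelopingι K ∘ₗ s
  have hh (a : L) : h (f a) = π (envelopingι K a) := by
    have := hkill (s (f a) - a) (by rw [map_sub, hs', sub_self])
    rw [map_sub, map_sub, sub_eq_zero] at this
    exact this
  refine ⟨envelopingLift h fun y z => ?_, enveloping_algHom_ext fun a => ?_⟩
  · obtain ⟨a, rfl⟩ := hf y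
    obtain ⟨b, rfl⟩ := hf z
    rw [← LieHom.map_lie, hh, hh, hh, envelopingι_lie]
    simp
  · rw [AlgHom.comp_apply, envelopingMap_ι, envelopingLift_ι, hh]

variable {J : Type*} {α : J → L}

local notation "B" => Algebra.adjoin K (Set.range fun j => UniversalEnvelopingAlgebra.ι K (α j))

/-- The subalgebra generated by the relations is mapped to scalars. On its positive part the scalar
is detected by the augmentation, which is compatible with `envelopingMap f` and vanishes in positive
degree. -/
theorem envelopingMap_eq_zero_of_mem_subalgebraIdeal {L' : Type*} [LieRing L'] [LieAlgebra K L']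
    {f : L →ₗ⁅K⁆ L'} (hα : ∀ j, f (α j) = 0) {u : UniversalEnvelopingAlgebra K L}
    (hu : u ∈ subalgebraIdeal (envelopingGrading ℒ) B) : envelopingMap f u = 0 := by
  have hB : ∀ b ∈ B, ∃ c, envelopingMap f b = algebraMap K _ c := by
    intro b hb
    induction hb using Algebra.adjoin_induction with
    | mem b hb =>
      obtain ⟨j, rfl⟩ := hb
      refine ⟨0, ?_⟩
      rw [map_zero]
      exact (envelopingMap_ι f (α j)).trans (by rw [hα, map_zero])
    | algebraMap c => exact ⟨c, AlgHom.commutes _ c⟩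
    | add a b _ _ ha hb =>
      obtain ⟨c, hc⟩ := ha
      obtain ⟨c', hc'⟩ := hb
      exact ⟨c + c', by rw [map_add, hc, hc', map_add]⟩
    | mul a b _ _ ha hb =>
      obtain ⟨c, hc⟩ := ha
      obtain ⟨c', hc'⟩ := hb
      exact ⟨c * c', by rw [map_mul, hc, hc', map_mul]⟩
  have hcounit : (envelopingCounit K L').comp (envelopingMap f) = envelopingCounit K L :=
    enveloping_algHom_ext fun a => by simp
  have hle : TwoSidedIdeal.span {b | b ∈ B ∧ b ∈ positivePart (envelopingGrading ℒ)} ≤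
      TwoSidedIdeal.ker (envelopingMap f) := by
    refine TwoSidedIdeal.span_le.2 ?_
    rintro b ⟨hb, hb'⟩
    obtain ⟨c, hc⟩ := hB b hb
    have h0 := DFunLike.congr_fun hcounit b
    rw [AlgHom.comp_apply, hc, AlgHom.commutes, envelopingCounit_of_mem_positivePart hb'] at h0
    refine (TwoSidedIdeal.mem_ker _).2 ?_
    rw [hc, show c = 0 from h0, map_zero]
  exact (TwoSidedIdeal.mem_ker _).1 (hle (TwoSidedIdeal.mem_asIdeal.1 hu))

/-- The quotient of `U(L)` by the ideal generated by relations `α` of positive degree, compared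
with the enveloping algebra of the Lie algebra with these relations. -/
theorem finrank_map_subalgebraQuotientMk {L' : Type*} [LieRing L'] [LieAlgebra K L']
    {f : L →ₗ⁅K⁆ L'} (hf : Function.Surjective f)
    {ℒ' : ℕ → Submodule K L'} (hℒ' : ∀ k, (ℒ k).map f.toLinearMap = ℒ' k)
    (hker : f.ker = LieSubmodule.lieSpan K L (Set.range α))
    (hα : ∀ j, ∃ k, α j ∈ ℒ (k + 1)) (k : ℕ) :
    Module.finrank K ((envelopingGrading ℒ k).map
      (subalgebraQuotientMk (envelopingGrading ℒ) B).toLinearMap) =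
      Module.finrank K (envelopingGrading ℒ' k) := by
  have hα0 (j : J) : f (α j) = 0 := by
    rw [← LieHom.mem_ker, hker]
    exact LieSubmodule.subset_lieSpan ⟨j, rfl⟩
  obtain ⟨g, hg⟩ := exists_comp_envelopingMap hf hker
    (subalgebraQuotientMk (envelopingGrading ℒ) B) fun j => by
      refine (Ideal.Quotient.eq_zero_iff_mem).2 (TwoSidedIdeal.mem_asIdeal.2
        (TwoSidedIdeal.subset_span ⟨Algebra.subset_adjoin ⟨j, rfl⟩, ?_⟩))
      obtain ⟨k, hk⟩ := hα j
      exact Submodule.mem_iSup_of_mem k (ι_mem_envelopingGrading hk)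
  -- Any `u` killed by the quotient map lies in the ideal, hence is already zero in `U(L')`.
  have hinj : Function.Injective g := by
    rw [injective_iff_map_eq_zero]
    intro v hv
    obtain ⟨u, rfl⟩ := envelopingMap_surjective hf v
    refine envelopingMap_eq_zero_of_mem_subalgebraIdeal (ℒ := ℒ) hα0 ?_
    rw [← AlgHom.comp_apply, hg] at hv
    exact (Ideal.Quotient.eq_zero_iff_mem).1 hv
  rw [← map_envelopingGrading f hℒ' k, ← hg, AlgHom.comp_toLinearMap, Submodule.map_comp]
  exact (Submodule.equivMapOfInjective g.toLinearMap hinj _).finrank_eq.symm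

end Presentation

/-! ### Free products -/

section FreeProducts

universe u v w
variable {K : Type u} [Field K] {B C : Type v} [Ring B] [Ring C] [Algebra K B] [Algebra K C]

/-- The universal property of the free product of two algebras. -/
def freeProdLift {A : Type w} [Semiring A] [Algebra K A] (f : B →ₐ[K] A) (g : C →ₐ[K] A) :
    FreeProd K B C →ₐ[K] A :=
  LinearAlgebra.FreeProduct.lift K (Factor B C) fun {i} => match i with
    | false => f
    | true => g

theorem freeProdLift_inl {A : Type w} [Semiring A] [Algebra K A] (f : B →ₐ[K] A) (g : C →ₐ[K] A)
    (b : B) : freeProdLift f g (FreeProd.inl K B C b) = f b :=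
  DFunLike.congr_fun (LinearAlgebra.FreeProduct.lift_comp_ι (I := Bool) (i := false)
    K (Factor B C) fun {i} => match i with
    | false => f
    | true => g) b

theorem freeProdLift_inr {A : Type w} [Semiring A] [Algebra K A] (f : B →ₐ[K] A) (g : C →ₐ[K] A)
    (c : C) : freeProdLift f g (FreeProd.inr K B C c) = g c :=
  DFunLike.congr_fun (LinearAlgebra.FreeProduct.lift_comp_ι (I := Bool) (i := true)
    K (Factor B C) fun {i} => match i with
    | false => f
    | true => g) c

theorem freeProd_algHom_ext {A : Type w} [Semiring A] [Algebra K A] {F G : FreeProd K B C →ₐ[K] A}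
    (hl : ∀ b, F (FreeProd.inl K B C b) = G (FreeProd.inl K B C b))
    (hr : ∀ c, F (FreeProd.inr K B C c) = G (FreeProd.inr K B C c)) : F = G := by
  have h : ∀ i, F.comp (LinearAlgebra.FreeProduct.ι K (Factor B C) i) =
      G.comp (LinearAlgebra.FreeProduct.ι K (Factor B C) i) := by
    rintro (_ | _)
    · exact AlgHom.ext hl
    · exact AlgHom.ext hr
  exact (LinearAlgebra.FreeProduct.lift_unique K (Factor B C)
    (fun {i} => G.comp (LinearAlgebra.FreeProduct.ι K (Factor B C) i)) F h).trans
    (LinearAlgebra.FreeProduct.lift_unique K (Factor B C)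
      (fun {i} => G.comp (LinearAlgebra.FreeProduct.ι K (Factor B C) i)) G fun _ => rfl).symm

/-- A subspace of the free product that contains `1` and is stable under left multiplication by
the two factors is everything. -/
theorem freeProd_submodule_eq_top {S : Submodule K (FreeProd K B C)} (h1 : 1 ∈ S)
    (hl : ∀ b, ∀ p ∈ S, FreeProd.inl K B C b * p ∈ S)
    (hr : ∀ c, ∀ p ∈ S, FreeProd.inr K B C c * p ∈ S) : S = ⊤ := by
  -- The elements whose left multiplication preserves `S` form a subalgebra containing both factors.
  -- The lift `F` to `T` shows that it is the whole free product.
  let T : Subalgebra K (FreeProd K B C) :=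
    { carrier := {q | ∀ p ∈ S, q * p ∈ S}
      mul_mem' := fun {a b} ha hb p hp => by rw [mul_assoc]; exact ha _ (hb p hp)
      add_mem' := fun {a b} ha hb p hp => by rw [add_mul]; exact add_mem (ha p hp) (hb p hp)
      algebraMap_mem' := fun c p hp => by
        rw [← Algebra.smul_def]; exact S.smul_mem c hp }
  let F : FreeProd K B C →ₐ[K] T :=
    freeProdLift ((FreeProd.inl K B C).codRestrict T hl) ((FreeProd.inr K B C).codRestrict T hr)
  have hF : T.val.comp F = AlgHom.id K _ := freeProd_algHom_ext
    (fun b => by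
      rw [AlgHom.comp_apply, freeProdLift_inl]; rfl)
    (fun c => by
      rw [AlgHom.comp_apply, freeProdLift_inr]; rfl)
  rw [eq_top_iff]
  intro q _
  have hq : q ∈ T := by
    rw [show q = T.val (F q) from (DFunLike.congr_fun hF q).symm]
    exact (F q).2
  simpa using hq 1 h1

variable {A : Type w} [Ring A] [Algebra K A] {B' : Submodule K B} {C' : Submodule K C}

theorem isAlternating_nil : IsAlternating B' C' [] :=
  ⟨List.isChain_nil, by simp, by simp⟩

theorem isAlternating_cons {x : B ⊕ C} {s : List (B ⊕ C)} :
    IsAlternating B' C' (x :: s) ↔ IsAlternating B' C' s ∧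
      (∀ y ∈ s.head?, x.isLeft ≠ y.isLeft) ∧ (∀ b, x = Sum.inl b → b ∈ B') ∧
        (∀ c, x = Sum.inr c → c ∈ C') := by
  simp only [IsAlternating, List.isChain_cons, List.mem_cons]
  constructor
  · rintro ⟨⟨h1, h2⟩, h3, h4⟩
    exact ⟨⟨h2, fun b hb => h3 b (.inr hb), fun c hc => h4 c (.inr hc)⟩, h1,
      fun b hb => h3 b (.inl hb.symm), fun c hc => h4 c (.inl hc.symm)⟩
  · rintro ⟨⟨h2, h3, h4⟩, h1, h5, h6⟩
    exact ⟨⟨h1, h2⟩, fun b hb => hb.elim (fun h => h5 b h.symm) (h3 b),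
      fun c hc => hc.elim (fun h => h6 c h.symm) (h4 c)⟩

local notation "word" => fun s : List (B ⊕ C) =>
  List.prod (List.map (Sum.elim (FreeProd.inl K B C) (FreeProd.inr K B C)) s)

/-- Left multiplication of an alternating word by an element of the first factor. -/
theorem exists_alternating_inl_mul (hB' : ∀ b ∈ B', ∀ b' ∈ B', b * b' ∈ B') (f : B →ₐ[K] A)
    (g : C →ₗ[K] A) {b : B} (hb : b ∈ B') {s : List (B ⊕ C)} (hs : IsAlternating B' C' s) :
    ∃ t, IsAlternating B' C' t ∧ (∀ y ∈ t.head?, y.isLeft = true) ∧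
      word t = FreeProd.inl K B C b * word s ∧
      (t.map (Sum.elim f g)).prod = f b * (s.map (Sum.elim f g)).prod := by
  rcases s with _ | ⟨b' | c, s⟩
  · exact ⟨[.inl b], isAlternating_cons.2 ⟨hs, by simp, by simpa using hb, by simp⟩, by simp,
      by simp, by simp⟩
  · rw [isAlternating_cons] at hs
    -- Two adjacent letters of `B` merge into one; the product in `A` is unchanged because `f` is
    -- multiplicative.
    refine ⟨.inl (b * b') :: s, isAlternating_cons.2 ⟨hs.1, hs.2.1, ?_, by simp⟩, by simp,
      by simp [mul_assoc], by simp [mul_assoc]⟩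
    rintro _ ⟨⟩
    exact hB' _ hb _ (hs.2.2.1 b' rfl)
  · exact ⟨.inl b :: .inr c :: s, isAlternating_cons.2 ⟨hs, by simp, by simpa using hb, by simp⟩,
      by simp, by simp, by simp⟩

/-- Left multiplication of an alternating word by an element of the second factor. -/
theorem exists_alternating_inr_mul (hC' : ∀ c ∈ C', ∀ c' ∈ C', c * c' ∈ C') {c : C} (hc : c ∈ C')
    {s : List (B ⊕ C)} (hs : IsAlternating B' C' s) :
    ∃ t, IsAlternating B' C' t ∧ word t = FreeProd.inr K B C c * word s := by
  -- Merging two letters of `C` need not respect products in `A`, as the map on `C` is only linear.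
  -- Hence nothing is claimed here about the image in `A`.
  rcases s with _ | ⟨b | c', s⟩
  · exact ⟨[.inr c], isAlternating_cons.2 ⟨hs, by simp, by simp, by simpa using hc⟩, by simp⟩
  · exact ⟨.inr c :: .inl b :: s, isAlternating_cons.2 ⟨hs, by simp, by simp, by simpa using hc⟩,
      by simp⟩
  · rw [isAlternating_cons] at hs
    refine ⟨.inr (c * c') :: s, isAlternating_cons.2 ⟨hs.1, hs.2.1, by simp, ?_⟩,
      by simp [mul_assoc]⟩
    rintro _ ⟨⟩
    exact hC' _ hc _ (hs.2.2.2 c' rfl)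

/-- The free product is spanned by the alternating words. -/
theorem span_alternating_eq_top (hB' : ∀ b ∈ B', ∀ b' ∈ B', b * b' ∈ B')
    (hC' : ∀ c ∈ C', ∀ c' ∈ C', c * c' ∈ C') (hB : Submodule.span K {1} ⊔ B' = ⊤)
    (hC : Submodule.span K {1} ⊔ C' = ⊤) :
    Submodule.span K {p | ∃ s, IsAlternating B' C' s ∧ word s = p} = ⊤ := by
  refine freeProd_submodule_eq_top (Submodule.subset_span ⟨[], isAlternating_nil, by simp⟩)
    (fun b p hp => ?_) (fun c p hp => ?_)
  · obtain ⟨_, h, b, hb, rfl⟩ := Submodule.mem_sup.1 (hB ▸ Submodule.mem_top : b ∈ _)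
    obtain ⟨a, rfl⟩ := Submodule.mem_span_singleton.1 h
    rw [map_add, map_smul, map_one, add_mul, smul_one_mul]
    refine add_mem (Submodule.smul_mem _ _ hp) ?_
    induction hp using Submodule.span_induction with
    | zero => simp
    | add p q _ _ hp hq => rw [mul_add]; exact add_mem hp hq
    | smul a p _ hp => rw [mul_smul_comm]; exact Submodule.smul_mem _ _ hp
    | mem p hp =>
      obtain ⟨s, hs, rfl⟩ := hp
      obtain ⟨t, ht, -, htw, -⟩ := exists_alternating_inl_mul hB' (AlgHom.id K B) 0 hb hs
      exact Submodule.subset_span ⟨t, ht, htw⟩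
  · obtain ⟨_, h, c, hc, rfl⟩ := Submodule.mem_sup.1 (hC ▸ Submodule.mem_top : c ∈ _)
    obtain ⟨a, rfl⟩ := Submodule.mem_span_singleton.1 h
    rw [map_add, map_smul, map_one, add_mul, smul_one_mul]
    refine add_mem (Submodule.smul_mem _ _ hp) ?_
    induction hp using Submodule.span_induction with
    | zero => simp
    | add p q _ _ hp hq => rw [mul_add]; exact add_mem hp hq
    | smul a p _ hp => rw [mul_smul_comm]; exact Submodule.smul_mem _ _ hp
    | mem p hp =>
      obtain ⟨s, hs, rfl⟩ := hp
      obtain ⟨t, ht, htw⟩ := exists_alternating_inr_mul hC' hc hs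
      exact Submodule.subset_span ⟨t, ht, htw⟩

variable {f : B →ₐ[K] A} {g : C →ₗ[K] A} {φ : FreeProd K B C →ₗ[K] A}

/-- The map `f * g` is compatible with left multiplication by the first factor. -/
theorem IsFreeProdMap.map_inl_mul (hφ : IsFreeProdMap B' C' f.toLinearMap g φ)
    (hB' : ∀ b ∈ B', ∀ b' ∈ B', b * b' ∈ B')
    (hC' : ∀ c ∈ C', ∀ c' ∈ C', c * c' ∈ C') (hB : Submodule.span K {1} ⊔ B' = ⊤)
    (hC : Submodule.span K {1} ⊔ C' = ⊤) {b : B} (hb : b ∈ B') (p : FreeProd K B C) :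
    φ (FreeProd.inl K B C b * p) = f b * φ p := by
  have hp := (span_alternating_eq_top hB' hC' hB hC).symm ▸ Submodule.mem_top (x := p)
  induction hp using Submodule.span_induction with
  | zero => simp
  | add p q _ _ hp hq => rw [mul_add, map_add, hp, hq, map_add, mul_add]
  | smul a p _ hp => rw [mul_smul_comm, map_smul, hp, map_smul, mul_smul_comm]
  | mem p hp =>
    obtain ⟨s, hs, rfl⟩ := hp
    obtain ⟨t, ht, -, htw, hta⟩ := exists_alternating_inl_mul hB' f g hb hs
    rw [← htw, hφ t ht, hφ s hs]
    exact hta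

/-- As `g` is only linear, `φ` need not commute with left multiplication by `C`. It does in front of
a letter of `B'`: the word for `b * p` begins in `B`, so prefixing `c ∈ C'` keeps it alternating and
no letters of `C` merge. The scalar part of `c` is handled by `g 1 = 1`. -/
theorem IsFreeProdMap.map_inr_mul_inl_mul (hφ : IsFreeProdMap B' C' f.toLinearMap g φ)
    (hB' : ∀ b ∈ B', ∀ b' ∈ B', b * b' ∈ B')
    (hC' : ∀ c ∈ C', ∀ c' ∈ C', c * c' ∈ C') (hB : Submodule.span K {1} ⊔ B' = ⊤)
    (hC : Submodule.span K {1} ⊔ C' = ⊤) (hg : g 1 = 1) (c : C) {b : B} (hb : b ∈ B')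
    (p : FreeProd K B C) :
    φ (FreeProd.inr K B C c * (FreeProd.inl K B C b * p)) = g c * (f b * φ p) := by
  obtain ⟨_, h, c, hc, rfl⟩ := Submodule.mem_sup.1 (hC ▸ Submodule.mem_top : c ∈ _)
  obtain ⟨a, rfl⟩ := Submodule.mem_span_singleton.1 h
  rw [map_add, map_smul, map_one, add_mul, smul_one_mul, map_add, map_smul,
    hφ.map_inl_mul hB' hC' hB hC hb, map_add, map_smul, hg, add_mul, smul_one_mul]
  congr 1
  have hp := (span_alternating_eq_top hB' hC' hB hC).symm ▸ Submodule.mem_top (x := p)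
  induction hp using Submodule.span_induction with
  | zero => simp
  | add p q _ _ hp hq => rw [mul_add, mul_add, map_add, hp, hq, map_add, mul_add, mul_add]
  | smul a p _ hp =>
    rw [mul_smul_comm, mul_smul_comm, map_smul, hp, map_smul, mul_smul_comm, mul_smul_comm]
  | mem p hp =>
    obtain ⟨s, hs, rfl⟩ := hp
    obtain ⟨t, ht, hleft, htw, hta⟩ := exists_alternating_inl_mul hB' f g hb hs
    have hct : IsAlternating B' C' (.inr c :: t) :=
      isAlternating_cons.2 ⟨ht, fun y hy => by simp [hleft y hy], by simp, by simpa using hc⟩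
    have := hφ _ hct
    rw [List.map_cons, List.prod_cons, List.map_cons, List.prod_cons] at this
    rw [← htw, hφ s hs]
    exact this.trans (congrArg (g c * ·) hta)

theorem IsFreeProdMap.map_one (hφ : IsFreeProdMap B' C' f.toLinearMap g φ) : φ 1 = 1 := by
  simpa using hφ [] isAlternating_nil

theorem IsFreeProdMap.map_inr (hφ : IsFreeProdMap B' C' f.toLinearMap g φ)
    (hC : Submodule.span K {1} ⊔ C' = ⊤) (hg : g 1 = 1) (c : C) :
    φ (FreeProd.inr K B C c) = g c := by
  obtain ⟨_, h, c, hc, rfl⟩ := Submodule.mem_sup.1 (hC ▸ Submodule.mem_top : c ∈ _)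
  obtain ⟨a, rfl⟩ := Submodule.mem_span_singleton.1 h
  have := hφ [.inr c] (isAlternating_cons.2
    ⟨isAlternating_nil, by simp, by simp, by simpa using hc⟩)
  simp only [List.map_cons, List.map_nil, List.prod_singleton, Sum.elim_inr] at this
  rw [map_add, map_smul, _root_.map_one, map_add, map_smul, hφ.map_one, this, map_add, map_smul, hg]

end FreeProducts

open scoped TensorProduct

/-! ### Free products with a free algebra -/

section Extension

universe u v w
variable {K : Type u} [Field K]

/-- The map `C ⊕ ⨁_j C ⊗ P → P` that sends `c` to `ρ c` and `c ⊗ p`, in the component with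
index `j`, to `ρ c * β j * p`. -/
def extMap {C P J : Type*} [AddCommMonoid C] [Module K C] [Semiring P] [Algebra K P]
    (ρ : C →ₗ[K] P) (β : J → P) : C × (J →₀ C ⊗[K] P) →ₗ[K] P :=
  LinearMap.coprod ρ (Finsupp.lsum K fun j =>
    TensorProduct.lift ((LinearMap.mul K P).compl₁₂ ρ (LinearMap.mulLeft K (β j))))

section

variable {C P J : Type*} [AddCommMonoid C] [Module K C] [Semiring P] [Algebra K P]
  (ρ : C →ₗ[K] P) (β : J → P)

theorem extMap_inl (c : C) : extMap ρ β (c, 0) = ρ c := by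
  simp [extMap]

theorem extMap_inr (j : J) (c : C) (p : P) :
    extMap ρ β (0, Finsupp.single j (c ⊗ₜ p)) = ρ c * (β j * p) := by
  simp [extMap]

/-- Two linear maps on `C ⊕ ⨁_j C ⊗ P` agree if they agree on the generators. -/
theorem ext_hom_ext {M : Type*} [AddCommMonoid M] [Module K M]
    {F G : C × (J →₀ C ⊗[K] P) →ₗ[K] M} (hl : ∀ c, F (c, 0) = G (c, 0))
    (hr : ∀ j c p, F (0, Finsupp.single j (c ⊗ₜ p)) = G (0, Finsupp.single j (c ⊗ₜ p))) :
    F = G := by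
  refine LinearMap.prod_ext (LinearMap.ext hl) (Finsupp.lhom_ext' fun j => ?_)
  exact TensorProduct.ext' (hr j)

end

section

variable {C P : Type*} [Semiring C] [Semiring P] [Algebra K C] [Algebra K P] {J : Type*}
  (ρ : C →ₐ[K] P) (β : J → P)

theorem extMap_smul (c : C) (n : C × (J →₀ C ⊗[K] P)) :
    extMap ρ.toLinearMap β (c • n) = ρ c * extMap ρ.toLinearMap β n := by
  have : extMap ρ.toLinearMap β ∘ₗ Algebra.lsmul K K (C × (J →₀ C ⊗[K] P)) c =
      LinearMap.mulLeft K (ρ c) ∘ₗ extMap ρ.toLinearMap β := by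
    refine ext_hom_ext (fun c' => ?_) (fun j c' p => ?_)
    · change extMap ρ.toLinearMap β (c • (c', 0)) = ρ c * extMap ρ.toLinearMap β (c', 0)
      rw [Prod.smul_mk, smul_zero, extMap_inl, extMap_inl]
      simp
    · change extMap ρ.toLinearMap β (c • (0, Finsupp.single j (c' ⊗ₜ p))) =
        ρ c * extMap ρ.toLinearMap β (0, Finsupp.single j (c' ⊗ₜ p))
      rw [Prod.smul_mk, smul_zero, Finsupp.smul_single, TensorProduct.smul_tmul', extMap_inr,
        extMap_inr]
      simp [mul_assoc]
  exact LinearMap.congr_fun this n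

/-- Left multiplication by `β j`, lifted along `extMap`. -/
def extAct (j : J) : Module.End K (C × (J →₀ C ⊗[K] P)) :=
  LinearMap.inr K C (J →₀ C ⊗[K] P) ∘ₗ Finsupp.lsingle j ∘ₗ
    TensorProduct.mk K C P 1 ∘ₗ extMap ρ.toLinearMap β

theorem extAct_apply (j : J) (n : C × (J →₀ C ⊗[K] P)) :
    extAct ρ β j n = (0, Finsupp.single j (1 ⊗ₜ extMap ρ.toLinearMap β n)) := rfl

/-- The inverse is an orbit map: `G` makes `C ⊕ ⨁ j, C ⊗ P` a left `P`-module, and `p ↦ G p (1, 0)`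
inverts `extMap`. One composite is checked with the induction principle for `P`, the other on the
generators of the sum. -/
theorem extMap_bijective
    (hind : ∀ S : Submodule K P, 1 ∈ S → (∀ c, ∀ p ∈ S, ρ c * p ∈ S) →
      (∀ j, ∀ p ∈ S, β j * p ∈ S) → S = ⊤)
    (G : P →ₐ[K] Module.End K (C × (J →₀ C ⊗[K] P)))
    (hGC : ∀ c n, G (ρ c) n = c • n) (hGB : ∀ j, G (β j) = extAct ρ β j) :
    Function.Bijective (extMap ρ.toLinearMap β) := by
  set Θ := extMap ρ.toLinearMap β
  have hinl (c : C) : Θ (c, 0) = ρ c := extMap_inl _ _ c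
  have hinr (j : J) (c : C) (p : P) : Θ (0, Finsupp.single j (c ⊗ₜ p)) = ρ c * (β j * p) :=
    extMap_inr _ _ j c p
  have h1 : Θ (1, 0) = 1 := (hinl 1).trans (map_one ρ)
  have hΘΓ (p : P) : Θ (G p (1, 0)) = p := by
    have : LinearMap.eqLocus (Θ ∘ₗ LinearMap.applyₗ (1, 0) ∘ₗ G.toLinearMap)
        LinearMap.id = ⊤ := by
      refine hind _ ?_ (fun c p hp => ?_) (fun j p hp => ?_)
      · change Θ (G 1 (1, 0)) = 1
        rw [map_one]
        exact h1
      · change Θ (G (ρ c * p) (1, 0)) = ρ c * p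
        replace hp : Θ (G p (1, 0)) = p := hp
        rw [map_mul, Module.End.mul_apply, hGC, extMap_smul, hp]
      · change Θ (G (β j * p) (1, 0)) = β j * p
        replace hp : Θ (G p (1, 0)) = p := hp
        rw [map_mul, Module.End.mul_apply, hGB, extAct_apply, hinr, map_one, one_mul, hp]
    exact (this.symm ▸ Submodule.mem_top : p ∈ LinearMap.eqLocus _ LinearMap.id)
  have hΓΘ : (LinearMap.applyₗ (1, 0) ∘ₗ G.toLinearMap) ∘ₗ Θ = LinearMap.id := by
    refine ext_hom_ext (fun c => ?_) (fun j c p => ?_)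
    · change G (Θ (c, 0)) (1, 0) = (c, 0)
      rw [hinl, hGC, Prod.smul_mk, smul_zero, smul_eq_mul, mul_one]
    · change G (Θ (0, Finsupp.single j (c ⊗ₜ p))) (1, 0) = (0, Finsupp.single j (c ⊗ₜ p))
      rw [hinr, map_mul, map_mul, Module.End.mul_apply, Module.End.mul_apply, hGC, hGB,
        extAct_apply, hΘΓ, Prod.smul_mk, smul_zero, Finsupp.smul_single,
        TensorProduct.smul_tmul', smul_eq_mul, mul_one]
  exact ⟨Function.LeftInverse.injective (g := fun p => G p (1, 0))
    fun n => LinearMap.congr_fun hΓΘ n, Function.RightInverse.surjective hΘΓ⟩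

end

variable {B C : Type v} [Ring B] [Ring C] [Algebra K B] [Algebra K C] {J : Type w}

/-- If `B` is the free algebra on the elements `β j` then
`B * C = C ⊕ ⨁_j C ⊗ β j ⊗ (B * C)`. -/
theorem extMap_freeProd_bijective (e : FreeAlgebra K J ≃ₐ[K] B) :
    Function.Bijective (extMap (FreeProd.inr K B C).toLinearMap
      fun j => FreeProd.inl K B C (e (FreeAlgebra.ι K j))) := by
  -- The module structure exists because `B` is free and the free product is a coproduct: the action
  -- of each `β j` may be prescribed arbitrarily and combined with the evident action of `C`.
  refine extMap_bijective _ _ (fun S h1 hC hB => freeProd_submodule_eq_top h1 (fun b => ?_) hC)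
    (freeProdLift ((FreeAlgebra.lift K (extAct (FreeProd.inr K B C)
      fun j => FreeProd.inl K B C (e (FreeAlgebra.ι K j)))).comp (e.symm : B →ₐ[K] FreeAlgebra K J))
      (Algebra.lsmul K K _)) (fun c n => ?_) (fun j => ?_)
  · obtain ⟨a, rfl⟩ := e.surjective b
    induction a using FreeAlgebra.induction with
    | grade0 r =>
      intro p hp
      rw [AlgEquiv.commutes, AlgHom.commutes, ← Algebra.smul_def]
      exact S.smul_mem r hp
    | grade1 j => exact hB j
    | mul a b ha hb =>
      intro p hp
      rw [map_mul, map_mul, mul_assoc]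
      exact ha _ (hb p hp)
    | add a b ha hb =>
      intro p hp
      rw [map_add, map_add, add_mul]
      exact add_mem (ha p hp) (hb p hp)
  · rw [freeProdLift_inr]
    rfl
  · rw [freeProdLift_inl]
    simp

end Extension

/-! ### Hilbert series and strongly free sets -/

section StronglyFree

universe u v
variable {K : Type u} [Field K]

/-- The Hilbert series of a graded space that decomposes as `C ⊕ ⨁_j C ⊗ α j ⊗ A`. -/
theorem hilbertSeries_eq_of_extMap_bijective {A : Type*} [Ring A] [Algebra K A] {C : Type*}
    [AddCommGroup C] [Module K C] {𝒜 : ℕ → Submodule K A} {𝒞 : ℕ → Submodule K C}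
    (h𝒜 : DirectSum.IsInternal 𝒜) (h𝒞 : DirectSum.IsInternal 𝒞)
    (hA : ∀ k, Module.Finite K (𝒜 k)) (hC : ∀ k, Module.Finite K (𝒞 k))
    (hmul : ∀ k l, ∀ a ∈ 𝒜 k, ∀ b ∈ 𝒜 l, a * b ∈ 𝒜 (k + l)) {J : Type*} [Fintype J]
    {α : J → A} {e : J → ℕ} (hα : ∀ j, α j ∈ 𝒜 (e j)) {ρ : C →ₗ[K] A}
    (hρ : ∀ k, ∀ c ∈ 𝒞 k, ρ c ∈ 𝒜 k) (hbij : Function.Bijective (extMap ρ α)) :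
    hilbertSeries 𝒜 = hilbertSeries 𝒞 +
      (∑ j, (PowerSeries.X : ℤ⟦X⟧) ^ e j) * (hilbertSeries 𝒞 * hilbertSeries 𝒜) := by
  obtain ⟨ιA, bA, wA, hbA⟩ := exists_homogeneous_basis h𝒜
  obtain ⟨ιC, bC, wC, hbC⟩ := exists_homogeneous_basis h𝒞
  have hfA (k : ℕ) := finite_fiber_of_homogeneous_basis h𝒜 bA wA hbA k
  have hfC (k : ℕ) := finite_fiber_of_homogeneous_basis h𝒞 bC wC hbC k
  -- Transporting bases through the bijection gives the homogeneous basis of `A` formed by the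
  -- elements `ρ c` and `ρ c * (α j * a)`.
  let b : Module.Basis (ιC ⊕ J × ιC × ιA) K A :=
    ((bC.prod (Finsupp.basis fun _ : J => bC.tensorProduct bA)).map
      (LinearEquiv.ofBijective _ hbij)).reindex
        (Equiv.sumCongr (Equiv.refl _) (Equiv.sigmaEquivProd J (ιC × ιA)))
  let w : ιC ⊕ J × ιC × ιA → ℕ := Sum.elim wC fun p => e p.1 + (wC p.2.1 + wA p.2.2)
  have hb (i) : b i ∈ 𝒜 (w i) := by
    rcases i with c | ⟨j, c, a⟩
    · have : b (.inl c) = ρ (bC c) := by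
        simp [b, extMap_inl]
      rw [this]
      exact hρ _ _ (hbC c)
    · have : b (.inr (j, c, a)) = ρ (bC c) * (α j * bA a) := by
        simp [b, extMap_inr]
      rw [this, show w (.inr (j, c, a)) = wC c + (e j + wA a) by simp only [w, Sum.elim_inr]; omega]
      exact hmul _ _ _ (hρ _ _ (hbC c)) _ (hmul _ _ _ (hα j) _ (hbA a))
  have hfCA := finite_fiber_prod hfC hfA
  have h := hilbertSeries_eq_weightSeries h𝒜 b w hb
  rw [weightSeries_sum _ _ hfC (finite_fiber_prod (fun k => inferInstance) hfCA),
    weightSeries_prod e (fun p : ιC × ιA => wC p.1 + wA p.2) (fun k => inferInstance) hfCA,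
    weightSeries_prod wC wA hfC hfA, weightSeries_fintype e,
    ← hilbertSeries_eq_weightSeries h𝒞 bC wC hbC, ← hilbertSeries_eq_weightSeries h𝒜 bA wA hbA] at h
  exact h

variable {A : Type v} [Ring A] [Algebra K A] {𝒜 : ℕ → Submodule K A}

theorem mul_mem_positivePart (hmul : ∀ k l, ∀ a ∈ 𝒜 k, ∀ b ∈ 𝒜 l, a * b ∈ 𝒜 (k + l)) {a b : A}
    (ha : a ∈ positivePart 𝒜) (hb : b ∈ positivePart 𝒜) : a * b ∈ positivePart 𝒜 := by
  unfold positivePart at *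
  induction ha using Submodule.iSup_induction' with
  | zero => simp
  | add a a' _ _ h h' => rw [add_mul]; exact add_mem h h'
  | mem k a ha =>
    induction hb using Submodule.iSup_induction' with
    | zero => simp
    | add b b' _ _ h h' => rw [mul_add]; exact add_mem h h'
    | mem l b hb => exact Submodule.mem_iSup_of_mem (k + 1 + l) (hmul _ _ a ha b hb)

theorem span_one_sup_positivePart (h0 : 𝒜 0 = Submodule.span K {1}) (htop : ⨆ k, 𝒜 k = ⊤) :
    Submodule.span K {1} ⊔ positivePart 𝒜 = ⊤ := by
  rw [← h0, ← htop]
  exact sup_iSup_nat_succ 𝒜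

/-- Because `ρ` is a degree-preserving section, `π ∘ p k ∘ ρ` are projections for the quotient. -/
theorem isInternal_map_subalgebraQuotientMk (h𝒜 : DirectSum.IsInternal 𝒜) {B : Subalgebra K A}
    {ρ : SubalgebraQuotient 𝒜 B →ₗ[K] A} (hρ : ∀ c, subalgebraQuotientMk 𝒜 B (ρ c) = c)
    (hρ' : ∀ k, ∀ a ∈ 𝒜 k, ρ (subalgebraQuotientMk 𝒜 B a) ∈ 𝒜 k) :
    DirectSum.IsInternal fun k => (𝒜 k).map (subalgebraQuotientMk 𝒜 B).toLinearMap := by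
  obtain ⟨p, -, hp, hp'⟩ := exists_projections h𝒜
  refine isInternal_of_projections
    (fun k => (subalgebraQuotientMk 𝒜 B).toLinearMap ∘ₗ p k ∘ₗ ρ) ?_ ?_ ?_
  · rintro k _ ⟨a, ha, rfl⟩
    change subalgebraQuotientMk 𝒜 B (p k (ρ (subalgebraQuotientMk 𝒜 B a))) = _
    rw [hp k _ (hρ' k a ha), hρ]
    rfl
  · rintro j k hjk _ ⟨a, ha, rfl⟩
    change subalgebraQuotientMk 𝒜 B (p k (ρ (subalgebraQuotientMk 𝒜 B a))) = _
    rw [hp' j k hjk _ (hρ' j a ha), map_zero]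
  · rw [← Submodule.map_iSup, h𝒜.submodule_iSup_eq_top, Submodule.map_top]
    exact LinearMap.range_eq_top.2 Ideal.Quotient.mk_surjective

/-- The decomposition of a connected graded algebra with respect to a weak summand that is free. -/
theorem exists_extMap_bijective (h𝒜 : DirectSum.IsInternal 𝒜)
    (h0 : 𝒜 0 = Submodule.span K {1})
    (hmul : ∀ k l, ∀ a ∈ 𝒜 k, ∀ b ∈ 𝒜 l, a * b ∈ 𝒜 (k + l)) {B : Subalgebra K A} {J : Type*}
    (e : FreeAlgebra K J ≃ₐ[K] B) {α : J → A} (he : ∀ j, (e (FreeAlgebra.ι K j) : A) = α j)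
    (hα : ∀ j, α j ∈ positivePart 𝒜) (hB : IsWeakSummand 𝒜 B) :
    ∃ ρ : SubalgebraQuotient 𝒜 B →ₗ[K] A,
      (∀ c, subalgebraQuotientMk 𝒜 B (ρ c) = c) ∧
      (∀ k, ∀ a ∈ 𝒜 k, ρ (subalgebraQuotientMk 𝒜 B a) ∈ 𝒜 k) ∧
      Function.Bijective (extMap ρ α) := by
  obtain ⟨ρ, hρ, hρ', φ, hφ, hbij⟩ := hB
  refine ⟨ρ, hρ, hρ', ?_⟩
  set π := subalgebraQuotientMk 𝒜 B
  have htop := span_one_sup_positivePart h0 h𝒜.submodule_iSup_eq_top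
  have hmulA {a b : A} := mul_mem_positivePart (a := a) (b := b) hmul
  replace hφ : IsFreeProdMap ((positivePart 𝒜).comap B.val.toLinearMap)
    ((positivePart 𝒜).map π.toLinearMap) B.val.toLinearMap ρ φ := hφ
  set B' := (positivePart 𝒜).comap B.val.toLinearMap
  set C' := (positivePart 𝒜).map π.toLinearMap
  have hB' : ∀ b ∈ B', ∀ b' ∈ B', b * b' ∈ B' := fun b hb b' hb' => hmulA hb hb'
  have hC' : ∀ c ∈ C', ∀ c' ∈ C', c * c' ∈ C' := by
    rintro _ ⟨a, ha, rfl⟩ _ ⟨b, hb, rfl⟩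
    exact ⟨a * b, hmulA ha hb, map_mul π a b⟩
  have hB : Submodule.span K {1} ⊔ B' = ⊤ := by
    rw [eq_top_iff]
    intro b _
    obtain ⟨_, h, a, ha, hb⟩ := Submodule.mem_sup.1 (htop ▸ Submodule.mem_top : (b : A) ∈ _)
    obtain ⟨r, rfl⟩ := Submodule.mem_span_singleton.1 h
    refine Submodule.mem_sup.2 ⟨r • 1, Submodule.mem_span_singleton.2 ⟨r, rfl⟩, b - r • 1, ?_,
      by abel⟩
    change (b : A) - r • 1 ∈ positivePart 𝒜
    rwa [← hb, add_sub_cancel_left]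
  have hC : Submodule.span K {1} ⊔ C' = ⊤ := by
    rw [eq_top_iff]
    intro c _
    obtain ⟨a, rfl⟩ := Ideal.Quotient.mk_surjective c
    obtain ⟨_, h, a, ha, rfl⟩ := Submodule.mem_sup.1 (htop ▸ Submodule.mem_top : a ∈ _)
    obtain ⟨r, rfl⟩ := Submodule.mem_span_singleton.1 h
    refine Submodule.mem_sup.2 ⟨r • 1, Submodule.mem_span_singleton.2 ⟨r, rfl⟩, π a,
      ⟨a, ha, rfl⟩, ?_⟩
    change r • 1 + π a = π (r • 1 + a)
    rw [map_add, map_smul, map_one]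
  -- Degree preservation puts `ρ 1` in `A_0 = K`, and the section property makes the scalar `1`. If
  -- the quotient is the zero ring, then `φ 1 = 1` forces `A` to be zero as well.
  have hρ1 : ρ 1 = 1 := by
    by_cases h : (1 : SubalgebraQuotient 𝒜 B) = 0
    · have h1 : (1 : A) = 0 := by
        rw [← hφ.map_one, ← map_one (FreeProd.inr K B (SubalgebraQuotient 𝒜 B)), h, map_zero,
          map_zero]
      rw [h, map_zero, h1]
    · have hmem : ρ 1 ∈ 𝒜 0 := by
        rw [← map_one π]
        exact hρ' 0 1 (h0 ▸ Submodule.mem_span_singleton_self 1)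
      rw [h0] at hmem
      obtain ⟨r, hr⟩ := Submodule.mem_span_singleton.1 hmem
      have := hρ 1
      rw [← hr, map_smul, map_one] at this
      have h' : (r - 1) • (1 : SubalgebraQuotient 𝒜 B) = 0 := by
        rw [sub_smul, this, one_smul, sub_self]
      rw [← hr, sub_eq_zero.1 ((smul_eq_zero.1 h').resolve_right h), one_smul]
  have heB (j : J) : e (FreeAlgebra.ι K j) ∈ B' := by
    change (e (FreeAlgebra.ι K j) : A) ∈ positivePart 𝒜
    rw [he]
    exact hα j
  let φe := LinearEquiv.ofBijective φ hbij
  -- The equivalence `E` replaces the tensor factor `B * C` by `A` through `φ`. In the resulting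
  -- square the other three maps are bijective, hence so is `extMap ρ α`.
  let E := LinearEquiv.prodCongr (LinearEquiv.refl K (SubalgebraQuotient 𝒜 B))
    (Finsupp.mapRange.linearEquiv (α := J)
      (TensorProduct.congr (LinearEquiv.refl K (SubalgebraQuotient 𝒜 B)) φe))
  have hcomm : extMap ρ α ∘ₗ E.toLinearMap =
      φ ∘ₗ extMap (FreeProd.inr K B (SubalgebraQuotient 𝒜 B)).toLinearMap
        (fun j => FreeProd.inl K B (SubalgebraQuotient 𝒜 B) (e (FreeAlgebra.ι K j))) := by
    refine ext_hom_ext (fun c => ?_) (fun j c p => ?_)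
    · rw [LinearMap.comp_apply, LinearMap.comp_apply, extMap_inl]
      refine Eq.trans ?_ (hφ.map_inr (f := B.val) hC hρ1 c).symm
      rw [← extMap_inl ρ α]
      exact congrArg _ (by simp [E])
    · rw [LinearMap.comp_apply, LinearMap.comp_apply, extMap_inr]
      refine Eq.trans ?_
        (hφ.map_inr_mul_inl_mul (f := B.val) hB' hC' hB hC hρ1 c (heB j) p).symm
      rw [Subalgebra.val_apply, he, ← extMap_inr ρ α]
      congr 1
      simp [E, φe]
  have hcomp : Function.Bijective (extMap ρ α ∘ E) := by
    have := hbij.comp (extMap_freeProd_bijective (C := SubalgebraQuotient 𝒜 B) e)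
    rw [← LinearMap.coe_comp, ← hcomm] at this
    exact this
  exact (Function.Bijective.of_comp_iff _ E.bijective).1 hcomp

/-- The Hilbert series of the quotient of a connected graded algebra by a strongly free set. -/
theorem IsStronglyFree.hilbertSeries_eq (h𝒜 : DirectSum.IsInternal 𝒜)
    (h0 : 𝒜 0 = Submodule.span K {1}) (hfin : ∀ k, Module.Finite K (𝒜 k))
    (hmul : ∀ k l, ∀ a ∈ 𝒜 k, ∀ b ∈ 𝒜 l, a * b ∈ 𝒜 (k + l)) {J : Type*} [Fintype J]
    {α : J → A} {e : J → ℕ} (hα : ∀ j, α j ∈ 𝒜 (e j)) (he : ∀ j, 1 ≤ e j)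
    (hfree : IsStronglyFree 𝒜 α) :
    hilbertSeries 𝒜 = hilbertSeries (fun k => (𝒜 k).map
        (subalgebraQuotientMk 𝒜 (Algebra.adjoin K (Set.range α))).toLinearMap) +
      (∑ j, (PowerSeries.X : ℤ⟦X⟧) ^ e j) * (hilbertSeries (fun k => (𝒜 k).map
        (subalgebraQuotientMk 𝒜 (Algebra.adjoin K (Set.range α))).toLinearMap) *
          hilbertSeries 𝒜) := by
  have hpos (j : J) : α j ∈ positivePart 𝒜 := by
    refine Submodule.mem_iSup_of_mem (e j - 1) ?_
    rw [Nat.sub_add_cancel (he j)]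
    exact hα j
  obtain ⟨ρ, hρ, hρ', hbij⟩ := exists_extMap_bijective h𝒜 h0 hmul
    ((AlgEquiv.ofInjective _ hfree.2.1).trans (Subalgebra.equivOfEq _ _
      (Algebra.adjoin_range_eq_range_freeAlgebra_lift K J α).symm))
    (fun j => FreeAlgebra.lift_ι_apply α j) hpos hfree.2.2
  refine hilbertSeries_eq_of_extMap_bijective h𝒜
    (isInternal_map_subalgebraQuotientMk h𝒜 hρ hρ') hfin
    (fun k => inferInstance) hmul hα (ρ := ρ) ?_ hbij
  rintro k _ ⟨a, ha, rfl⟩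
  exact hρ' k a ha

end StronglyFree

/-! ### Enveloping algebras of one-dimensional extensions -/

section EnvelopingDerivation

variable {K : Type*} [Field K] {L : Type*} [LieRing L] [LieAlgebra K L]

local notation "U" => UniversalEnvelopingAlgebra K L

/-- The action of a Lie algebra `L` on `U(L) ⊕ U(L)` that is twisted by a derivation. -/
def derivationAction (δ : L →ₗ[K] L) : L →ₗ[K] Module.End K (U × U) where
  toFun y := (LinearMap.mulLeft K (envelopingι K y) ∘ₗ LinearMap.fst K U U).prod
    (LinearMap.mulLeft K (envelopingι K (δ y)) ∘ₗ LinearMap.fst K U U +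
      LinearMap.mulLeft K (envelopingι K y) ∘ₗ LinearMap.snd K U U)
  map_add' y z := by
    ext <;> simp [add_mul]
  map_smul' c y := by
    ext <;> simp

theorem derivationAction_apply (δ : L →ₗ[K] L) (y : L) (u : U × U) :
    derivationAction δ y u =
      (envelopingι K y * u.1, envelopingι K (δ y) * u.1 + envelopingι K y * u.2) := rfl

/-- A derivation of a Lie algebra extends to a derivation of the enveloping algebra. -/
theorem exists_envelopingDerivation (δ : L →ₗ[K] L)
    (hδ : ∀ y z : L, δ ⁅y, z⁆ = ⁅δ y, z⁆ + ⁅y, δ z⁆) :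
    ∃ D : U →ₗ[K] U, D 1 = 0 ∧ ∀ (y : L) (u : U),
      D (envelopingι K y * u) = envelopingι K (δ y) * u + envelopingι K y * D u := by
  -- Each `y` acts by the lower triangular matrix with diagonal entries `y` and corner `δ y`. In `E
  -- u (1, 0)` the first coordinate is `u`, and the second is taken as `D u`.
  let E : U →ₐ[K] Module.End K (U × U) := envelopingLift (derivationAction δ) fun y z => by
    refine LinearMap.ext fun u => Prod.ext ?_ ?_
    · simp [derivationAction_apply, envelopingι_lie, sub_mul, mul_assoc]
    · simp only [derivationAction_apply, hδ, map_add, envelopingι_lie, LinearMap.sub_apply,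
        Module.End.mul_apply, Prod.snd_sub]
      noncomm_ring
  have hE (y : L) : E (envelopingι K y) = derivationAction δ y := envelopingLift_ι _ _ y
  have hfst (u : U) : (E u (1, 0)).1 = u := by
    have : LinearMap.eqLocus (LinearMap.fst K U U ∘ₗ LinearMap.applyₗ (1, 0) ∘ₗ E.toLinearMap)
        LinearMap.id = ⊤ := by
      refine enveloping_submodule_eq_top ?_ fun y u hu => ?_
      · change (E 1 (1, 0)).1 = 1
        rw [map_one]
        rfl
      · replace hu : (E u (1, 0)).1 = u := hu
        change (E (envelopingι K y * u) (1, 0)).1 = envelopingι K y * u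
        rw [map_mul, Module.End.mul_apply, hE, derivationAction_apply, hu]
    exact (this.symm ▸ Submodule.mem_top : u ∈ LinearMap.eqLocus _ LinearMap.id)
  refine ⟨LinearMap.snd K U U ∘ₗ LinearMap.applyₗ (1, 0) ∘ₗ E.toLinearMap, ?_, fun y u => ?_⟩
  · change (E 1 (1, 0)).2 = 0
    rw [map_one]
    rfl
  · change (E (envelopingι K y * u) (1, 0)).2 = _ + _ * (E u (1, 0)).2
    rw [map_mul, Module.End.mul_apply, hE, derivationAction_apply, hfst]

end EnvelopingDerivation

section Extension

variable {K : Type*} [Field K] {L : Type*} [LieRing L] [LieAlgebra K L]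

/-- The kernel of a linear functional that vanishes on brackets. -/
def characterKer (f : L →ₗ[K] K) (hf : ∀ y z : L, f ⁅y, z⁆ = 0) : LieSubalgebra K L :=
  { toSubmodule := LinearMap.ker f
    lie_mem' := fun _ _ => hf _ _ }

variable {f : L →ₗ[K] K} {hf : ∀ y z : L, f ⁅y, z⁆ = 0} {x : L}

local notation "I" => characterKer f hf
local notation "W" => UniversalEnvelopingAlgebra K L
local notation "V" => UniversalEnvelopingAlgebra K (characterKer f hf)

theorem mem_characterKer {y : L} : y ∈ I ↔ f y = 0 := Iff.rfl

/-- The projection to the kernel of `f` along `x`. -/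
def characterProj (hx : f x = 1) : L →ₗ[K] I :=
  LinearMap.codRestrict (LinearMap.ker f) (LinearMap.id - f.smulRight x) fun y => by
    simp [hx]

theorem coe_characterProj (hx : f x = 1) (y : L) :
    (characterProj (hf := hf) hx y : L) = y - f y • x := rfl

theorem characterProj_coe (hx : f x = 1) (y : I) : characterProj hx (y : L) = y := by
  refine Subtype.ext ?_
  rw [coe_characterProj, mem_characterKer.1 y.2, zero_smul, sub_zero]

theorem characterProj_self (hx : f x = 1) : characterProj (hf := hf) hx x = 0 := by
  refine Subtype.ext ?_
  rw [coe_characterProj, hx, one_smul, sub_self]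
  rfl

/-- The restriction of `ad x` to the kernel of `f`. -/
def characterAd (f : L →ₗ[K] K) (hf : ∀ y z : L, f ⁅y, z⁆ = 0) (x : L) :
    characterKer f hf →ₗ[K] characterKer f hf where
  toFun y := ⟨⁅x, (y : L)⁆, hf _ _⟩
  map_add' y z := Subtype.ext (lie_add x (y : L) (z : L))
  map_smul' c y := Subtype.ext (lie_smul c x (y : L))

theorem characterAd_lie (y z : I) :
    characterAd f hf x ⁅y, z⁆ = ⁅characterAd f hf x y, z⁆ + ⁅y, characterAd f hf x z⁆ := by
  refine Subtype.ext ?_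
  exact leibniz_lie x (y : L) (z : L)

/-- Expand the bracket after writing `y` as its projection plus `f y • x`, and likewise `z`. This is
the identity that makes `extensionAction` a representation. -/
theorem characterProj_lie (hx : f x = 1) (y z : L) :
    characterProj (hf := hf) hx ⁅y, z⁆ =
      ⁅characterProj (hf := hf) hx y, characterProj hx z⁆ +
        f y • characterAd f hf x (characterProj hx z) -
          f z • characterAd f hf x (characterProj hx y) := by
  refine Subtype.ext ?_
  change _ = ⁅(characterProj (hf := hf) hx y : L), (characterProj (hf := hf) hx z : L)⁆ +
    f y • ⁅x, (characterProj (hf := hf) hx z : L)⁆ - f z • ⁅x, (characterProj (hf := hf) hx y : L)⁆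
  simp only [coe_characterProj, hf, zero_smul, sub_zero, lie_sub, sub_lie, lie_smul, smul_lie,
    lie_self, smul_zero]
  rw [← lie_skew x y, smul_neg]
  abel

/-- The action of `L` on `U(I) ⊕ U(L)`, where `(u, w)` stands for `u + w x`. -/
def extensionAction (hx : f x = 1) (D : V →ₗ[K] V) : L →ₗ[K] Module.End K (V × W) where
  toFun y := (LinearMap.mulLeft K (envelopingι K (characterProj (hf := hf) hx y)) ∘ₗ
      LinearMap.fst K V W + f y • D ∘ₗ LinearMap.fst K V W).prod
    (LinearMap.mulLeft K (envelopingι K y) ∘ₗ LinearMap.snd K V W +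
      f y • (envelopingMap (I).incl).toLinearMap ∘ₗ LinearMap.fst K V W)
  map_add' y z := by
    ext <;> simp [add_mul, add_smul]
    all_goals abel
  map_smul' c y := by
    ext <;> simp [mul_smul]

theorem extensionAction_apply (hx : f x = 1) (D : V →ₗ[K] V) (y : L) (n : V × W) :
    extensionAction hx D y n =
      (envelopingι K (characterProj (hf := hf) hx y) * n.1 + f y • D n.1,
        envelopingι K y * n.2 + f y • envelopingMap (I).incl n.1) := rfl

/-- The decomposition `U(L) = U(I) ⊕ U(L) x`, as a map. -/
def extensionMap (f : L →ₗ[K] K) (hf : ∀ y z : L, f ⁅y, z⁆ = 0) (x : L) :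
    UniversalEnvelopingAlgebra K (characterKer f hf) × W →ₗ[K] W :=
  LinearMap.coprod (envelopingMap (characterKer f hf).incl).toLinearMap
    (LinearMap.mulRight K (envelopingι K x))

theorem extensionMap_apply (n : V × W) :
    extensionMap f hf x n = envelopingMap (I).incl n.1 + n.2 * envelopingι K x := rfl

/-- This is the step that replaces the Poincaré–Birkhoff–Witt theorem. The rule `x u = u x + D u`
suggests an action of `L` on `U(I) ⊕ U(L)`; once it is known to be a representation, `w ↦ w · (1,
0)` is a left inverse: `u ∈ U(I)` goes to `(u, 0)` and `w x` to `(0, w)`. -/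
theorem extensionMap_injective (hx : f x = 1) : Function.Injective (extensionMap f hf x) := by
  obtain ⟨D, hD1, hD⟩ := exists_envelopingDerivation (characterAd f hf x) characterAd_lie
  let G : W →ₐ[K] Module.End K (V × W) := envelopingLift (extensionAction hx D) fun y z => by
    have hy : envelopingMap (I).incl (envelopingι K (characterProj hx y)) =
        envelopingι K y - f y • envelopingι K x := by
      rw [envelopingMap_ι, ← map_smul, ← map_sub]
      rfl
    have hz : envelopingMap (I).incl (envelopingι K (characterProj hx z)) =
        envelopingι K z - f z • envelopingι K x := by
      rw [envelopingMap_ι, ← map_smul, ← map_sub]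
      rfl
    refine LinearMap.ext fun n => Prod.ext ?_ ?_
    · simp only [extensionAction_apply, LinearMap.sub_apply, Module.End.mul_apply, Prod.fst_sub, hf,
        characterProj_lie, map_sub, map_add, map_smul, envelopingι_lie, hD, zero_smul, add_zero,
        sub_mul, add_mul, mul_add, smul_mul_assoc, mul_smul_comm, smul_add, mul_assoc]
      rw [smul_comm (f y) (f z)]
      abel
    · simp only [extensionAction_apply, LinearMap.sub_apply, Module.End.mul_apply, Prod.snd_sub, hf,
        map_add, map_smul, map_mul, hy, hz, envelopingι_lie, zero_smul, add_zero,
        sub_mul, mul_add, smul_mul_assoc, mul_smul_comm, smul_add, smul_sub, mul_assoc]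
      rw [smul_comm (f y) (f z), smul_comm (f y) (f z)]
      abel
  have hG (y : L) : G (envelopingι K y) = extensionAction hx D y := envelopingLift_ι _ _ y
  have hl (u : V) : G (envelopingMap (I).incl u) (1, 0) = (u, 0) := by
    have : LinearMap.eqLocus (LinearMap.applyₗ (1, 0) ∘ₗ G.toLinearMap ∘ₗ
        (envelopingMap (I).incl).toLinearMap) (LinearMap.inl K V W) = ⊤ := by
      refine enveloping_submodule_eq_top ?_ fun y u hu => ?_
      · change G (envelopingMap (I).incl 1) (1, 0) = (1, 0)
        rw [map_one, map_one]
        rfl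
      · replace hu : G (envelopingMap (I).incl u) (1, 0) = (u, 0) := hu
        change G (envelopingMap (I).incl (envelopingι K y * u)) (1, 0) = (envelopingι K y * u, 0)
        rw [map_mul, map_mul, Module.End.mul_apply, hu, envelopingMap_ι, hG, extensionAction_apply]
        have hy : f ((I).incl y) = 0 := mem_characterKer.1 y.2
        rw [hy, LieSubalgebra.coe_incl, characterProj_coe]
        simp
    exact (this.symm ▸ Submodule.mem_top : u ∈ LinearMap.eqLocus _ (LinearMap.inl K V W))
  have hr (w : W) : G w (0, 1) = (0, w) := by
    have : LinearMap.eqLocus (LinearMap.applyₗ (0, 1) ∘ₗ G.toLinearMap) (LinearMap.inr K V W) =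
        ⊤ := by
      refine enveloping_submodule_eq_top ?_ fun y w hw => ?_
      · change G 1 (0, 1) = (0, 1)
        rw [map_one]
        rfl
      · replace hw : G w (0, 1) = (0, w) := hw
        change G (envelopingι K y * w) (0, 1) = (0, envelopingι K y * w)
        rw [map_mul, Module.End.mul_apply, hw, hG, extensionAction_apply]
        simp
    exact (this.symm ▸ Submodule.mem_top : w ∈ LinearMap.eqLocus _ (LinearMap.inr K V W))
  have hx1 : G (envelopingι K x) (1, 0) = (0, 1) := by
    rw [hG, extensionAction_apply, characterProj_self, hx, hD1]
    simp
  refine Function.LeftInverse.injective (g := fun w => G w (1, 0)) fun n => ?_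
  change G (extensionMap f hf x n) (1, 0) = n
  rw [extensionMap_apply, map_add, LinearMap.add_apply, hl, map_mul, Module.End.mul_apply, hx1, hr]
  simp

/-- The grading of the kernel of `f` induced by a grading of `L`. -/
def characterGrading (ℒ : ℕ → Submodule K L) (f : L →ₗ[K] K) (hf : ∀ y z : L, f ⁅y, z⁆ = 0)
    (k : ℕ) : Submodule K (characterKer f hf) :=
  (ℒ k).comap (characterKer f hf).incl.toLinearMap

variable {ℒ : ℕ → Submodule K L} {d : ℕ}

theorem characterProj_mem (hx : f x = 1) (hxd : x ∈ ℒ d) (hfd : ∀ k, k ≠ d → ∀ y ∈ ℒ k, f y = 0)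
    {k : ℕ} {y : L} (hy : y ∈ ℒ k) : characterProj hx y ∈ characterGrading ℒ f hf k := by
  change y - f y • x ∈ ℒ k
  by_cases hk : k = d
  · subst hk
    exact sub_mem hy (Submodule.smul_mem _ _ hxd)
  · rwa [hfd k hk y hy, zero_smul, sub_zero]

theorem isLieGrading_characterKer (hx : f x = 1) (hℒ : IsLieGrading ℒ) (hxd : x ∈ ℒ d)
    (hfd : ∀ k, k ≠ d → ∀ y ∈ ℒ k, f y = 0) :
    IsLieGrading (characterGrading ℒ f hf) where
  isInternal := by
    obtain ⟨p, -, hp, hp'⟩ := exists_projections hℒ.isInternal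
    refine isInternal_of_projections
      (fun k => characterProj hx ∘ₗ p k ∘ₗ (I).incl.toLinearMap) (fun k y hy => ?_)
      (fun j k hjk y hy => ?_) ?_
    · change characterProj hx (p k (y : L)) = y
      rw [hp k (y : L) hy, characterProj_coe]
    · change characterProj hx (p k (y : L)) = 0
      rw [hp' j k hjk (y : L) hy, map_zero]
    · have : ⨆ k, ℒ k ≤ (⨆ k, characterGrading ℒ f hf k).comap
          (characterProj (hf := hf) hx) :=
        iSup_le fun k y hy => Submodule.mem_iSup_of_mem k (characterProj_mem hx hxd hfd hy)
      rw [hℒ.isInternal.submodule_iSup_eq_top] at this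
      rw [eq_top_iff]
      intro y _
      have hy := this (Submodule.mem_top (x := (y : L)))
      rwa [Submodule.mem_comap, characterProj_coe] at hy
  zero_eq_bot := by
    rw [characterGrading, hℒ.zero_eq_bot, Submodule.comap_bot]
    exact Submodule.ker_subtype _
  lie_mem k l y z hy hz := hℒ.lie_mem k l _ _ hy hz

theorem finrank_characterGrading (k : ℕ) :
    Module.finrank K (characterGrading ℒ f hf k) = Module.finrank K ↥(LinearMap.ker f ⊓ ℒ k) := by
  rw [← Submodule.map_comap_subtype, Submodule.finrank_map_subtype_eq]
  rfl

theorem finrank_characterGrading_of_ne (hfd : ∀ k, k ≠ d → ∀ y ∈ ℒ k, f y = 0) {k : ℕ}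
    (hk : k ≠ d) :
    Module.finrank K (characterGrading ℒ f hf k) = Module.finrank K (ℒ k) := by
  have hle : ℒ k ≤ LinearMap.ker f := fun y hy => hfd k hk y hy
  rw [finrank_characterGrading, inf_eq_right.2 hle]

theorem finrank_characterGrading_add_one (hx : f x = 1) (hxd : x ∈ ℒ d)
    [Module.Finite K (ℒ d)] :
    Module.finrank K (characterGrading ℒ f hf d) + 1 = Module.finrank K (ℒ d) := by
  have hrange : LinearMap.range (f.domRestrict (ℒ d)) = ⊤ := by
    rw [LinearMap.range_eq_top]
    intro c
    refine ⟨c • ⟨x, hxd⟩, ?_⟩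
    rw [map_smul, LinearMap.domRestrict_apply, hx, smul_eq_mul, mul_one]
  have hker : Module.finrank K (LinearMap.ker (f.domRestrict (ℒ d))) =
      Module.finrank K (characterGrading ℒ f hf d) := by
    rw [finrank_characterGrading, inf_comm, ← Submodule.map_comap_subtype,
      Submodule.finrank_map_subtype_eq]
    rfl
  have := LinearMap.finrank_range_add_finrank_ker (f.domRestrict (ℒ d))
  rw [hrange, finrank_top, Module.finrank_self, hker] at this
  omega

/-- Commutation of `x` with the elements of `U(I)`. -/
theorem exists_ι_mul_eq (hxd : x ∈ ℒ d) (hℒ : IsLieGrading ℒ) :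
    ∃ D : V →ₗ[K] V,
      (∀ v, envelopingι K x * envelopingMap (I).incl v =
        envelopingMap (I).incl v * envelopingι K x + envelopingMap (I).incl (D v)) ∧
      ∀ k, ∀ v ∈ envelopingGrading (characterGrading ℒ f hf) k,
        D v ∈ envelopingGrading (characterGrading ℒ f hf) (d + k) := by
  obtain ⟨D, hD1, hD⟩ := exists_envelopingDerivation (characterAd f hf x) characterAd_lie
  refine ⟨D, fun v => ?_, fun k => ?_⟩
  · have : LinearMap.eqLocus
        (LinearMap.mulLeft K (envelopingι K x) ∘ₗ (envelopingMap (I).incl).toLinearMap)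
        (LinearMap.mulRight K (envelopingι K x) ∘ₗ (envelopingMap (I).incl).toLinearMap +
          (envelopingMap (I).incl).toLinearMap ∘ₗ D) = ⊤ := by
      refine enveloping_submodule_eq_top ?_ fun y v hv => ?_
      · change envelopingι K x * envelopingMap (I).incl 1 =
          envelopingMap (I).incl 1 * envelopingι K x + envelopingMap (I).incl (D 1)
        rw [map_one, hD1, map_zero, one_mul, mul_one, add_zero]
      · replace hv : envelopingι K x * envelopingMap (I).incl v =
          envelopingMap (I).incl v * envelopingι K x + envelopingMap (I).incl (D v) := hv
        change envelopingι K x * envelopingMap (I).incl (envelopingι K y * v) =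
          envelopingMap (I).incl (envelopingι K y * v) * envelopingι K x +
            envelopingMap (I).incl (D (envelopingι K y * v))
        have hy : envelopingι K ((I).incl (characterAd f hf x y)) =
            envelopingι K x * envelopingι K ((I).incl y) -
              envelopingι K ((I).incl y) * envelopingι K x := envelopingι_lie x (y : L)
        rw [hD, map_add, map_mul, map_mul, map_mul, envelopingMap_ι, envelopingMap_ι, hy, sub_mul,
          mul_assoc (envelopingι K ((I).incl y)) (envelopingMap (I).incl v),
          mul_assoc _ _ (envelopingMap (I).incl v), mul_assoc _ _ (envelopingMap (I).incl v), hv,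
          mul_add]
        abel
    exact (this.symm ▸ Submodule.mem_top : v ∈ LinearMap.eqLocus _ _)
  · suffices h : ∀ v ∈ envelopingGrading (characterGrading ℒ f hf) k,
        v ∈ (envelopingGrading (characterGrading ℒ f hf) k) ⊓
          (envelopingGrading (characterGrading ℒ f hf) (d + k)).comap D from
      fun v hv => (h v hv).2
    refine envelopingGrading_le (S := fun k =>
      (envelopingGrading (characterGrading ℒ f hf) k) ⊓
        (envelopingGrading (characterGrading ℒ f hf) (d + k)).comap D)
      ⟨one_mem_envelopingGrading, ?_⟩ (fun k l y hy v hv => ⟨?_, ?_⟩) k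
    · change D 1 ∈ envelopingGrading (characterGrading ℒ f hf) (d + 0)
      rw [hD1]
      exact zero_mem _
    · exact ι_mul_mem_envelopingGrading hy hv.1
    · change D (envelopingι K y * v) ∈
        envelopingGrading (characterGrading ℒ f hf) (d + (k + l))
      rw [hD]
      refine add_mem ?_ ?_
      · rw [← add_assoc]
        refine ι_mul_mem_envelopingGrading (ℒ := characterGrading ℒ f hf) ?_ hv.1
        exact hℒ.lie_mem d k x (y : L) hxd hy
      · rw [add_left_comm]
        exact ι_mul_mem_envelopingGrading hy hv.2

theorem finite_characterGrading (k : ℕ) [Module.Finite K (ℒ k)] :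
    Module.Finite K (characterGrading ℒ f hf k) :=
  Module.Finite.of_injective ((I).incl.toLinearMap.restrict (p := characterGrading ℒ f hf k)
    (q := ℒ k) fun _ h => h) fun _ _ h =>
      Subtype.ext (Subtype.ext (congrArg (Subtype.val : ℒ k → L) h))

theorem finrank_prod_submodule {M N : Type*} [AddCommGroup M] [Module K M] [AddCommGroup N]
    [Module K N] (p : Submodule K M) (q : Submodule K N) [Module.Finite K p] [Module.Finite K q] :
    Module.finrank K (p.prod q) = Module.finrank K p + Module.finrank K q := by
  have hrange : p.prod q = LinearMap.range (p.subtype.prodMap q.subtype) := by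
    rw [LinearMap.range_prodMap, Submodule.range_subtype, Submodule.range_subtype]
  rw [hrange, LinearMap.finrank_range_of_inj
    (Function.Injective.prodMap p.subtype_injective q.subtype_injective), Module.finrank_prod]

/-- The images contain `1` and are stable under homogeneous `y`: split `y` into its projection plus
`f y • x` and move `x` to the right past `U(I)`. The value `⊥` for `k < d` guards against truncated
subtraction. -/
theorem map_extensionMap (hx : f x = 1) (hxd : x ∈ ℒ d) (hℒ : IsLieGrading ℒ)
    (hfd : ∀ k, k ≠ d → ∀ y ∈ ℒ k, f y = 0) (k : ℕ) :
    ((envelopingGrading (characterGrading ℒ f hf) k).prod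
      (if d ≤ k then envelopingGrading ℒ (k - d) else ⊥)).map (extensionMap f hf x) =
        envelopingGrading ℒ k := by
  have hincl (k : ℕ) : ∀ v ∈ envelopingGrading (characterGrading ℒ f hf) k,
      envelopingMap (I).incl v ∈ envelopingGrading ℒ k := by
    refine envelopingGrading_le (S := fun k =>
      (envelopingGrading ℒ k).comap (envelopingMap (I).incl).toLinearMap) ?_ ?_ k
    · simpa using one_mem_envelopingGrading
    · intro k l y hy v hv
      change envelopingMap (I).incl (envelopingι K y * v) ∈ envelopingGrading ℒ (k + l)
      rw [map_mul, envelopingMap_ι]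
      exact ι_mul_mem_envelopingGrading (ℒ := ℒ) hy hv
  refine le_antisymm ?_ (envelopingGrading_le (S := fun k =>
    ((envelopingGrading (characterGrading ℒ f hf) k).prod
      (if d ≤ k then envelopingGrading ℒ (k - d) else ⊥)).map (extensionMap f hf x)) ?_ ?_ k)
  · rintro _ ⟨⟨v, w⟩, ⟨hv, hw⟩, rfl⟩
    rw [extensionMap_apply]
    refine add_mem (hincl k v hv) ?_
    dsimp only at hw
    split_ifs at hw with hdk
    · have := mul_mem_envelopingGrading hw (ι_mem_envelopingGrading hxd)
      rwa [Nat.sub_add_cancel hdk] at this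
    · rw [SetLike.mem_coe, Submodule.mem_bot] at hw
      rw [hw, zero_mul]
      exact zero_mem _
  · refine ⟨(1, 0), ⟨one_mem_envelopingGrading, zero_mem _⟩, ?_⟩
    rw [extensionMap_apply, map_one, zero_mul, add_zero]
  · rintro k l y hy _ ⟨⟨v, w⟩, ⟨hv, hw⟩, rfl⟩
    obtain ⟨D, hD, hDk⟩ := exists_ι_mul_eq (hf := hf) hxd hℒ
    have hy' : envelopingι K y =
        envelopingMap (I).incl (envelopingι K (characterProj hx y)) + f y • envelopingι K x := by
      rw [envelopingMap_ι, ← map_smul, ← map_add]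
      congr 1
      exact (sub_add_cancel y _).symm
    refine ⟨(envelopingι K (characterProj hx y) * v + f y • D v,
      f y • envelopingMap (I).incl v + envelopingι K y * w), ⟨?_, ?_⟩, ?_⟩
    · refine add_mem (ι_mul_mem_envelopingGrading (characterProj_mem hx hxd hfd hy) hv) ?_
      by_cases hk : k = d
      · subst hk
        exact Submodule.smul_mem _ _ (hDk l v hv)
      · rw [hfd k hk y hy, zero_smul]
        exact zero_mem _
    · refine add_mem ?_ ?_
      · by_cases hk : k = d
        · subst hk
          rw [if_pos (Nat.le_add_right k l), Nat.add_sub_cancel_left]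
          exact Submodule.smul_mem _ _ (hincl l v hv)
        · rw [hfd k hk y hy, zero_smul]
          exact zero_mem _
      · dsimp only at hw
        split_ifs at hw with hdl
        · rw [if_pos (hdl.trans (Nat.le_add_left l k)), Nat.add_sub_assoc hdl]
          exact ι_mul_mem_envelopingGrading hy hw
        · rw [SetLike.mem_coe, Submodule.mem_bot] at hw
          rw [hw, mul_zero]
          exact zero_mem _
    · simp only [extensionMap_apply, map_add, map_mul, map_smul, mul_add, add_mul, smul_mul_assoc,
        ← mul_assoc]
      have h2 : envelopingι K y * envelopingMap (I).incl v =
          envelopingMap (I).incl (envelopingι K (characterProj hx y)) * envelopingMap (I).incl v +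
            f y • (envelopingMap (I).incl v * envelopingι K x + envelopingMap (I).incl (D v)) := by
        rw [← hD v, hy', add_mul, smul_mul_assoc]
      rw [h2, smul_add]
      abel

/-- The Hilbert series of `U(L)` and of `U(I)`, for an ideal `I` of codimension one. -/
theorem hilbertSeries_mul_one_sub_X_pow (hx : f x = 1) (hxd : x ∈ ℒ d) (hℒ : IsLieGrading ℒ)
    (hfin : ∀ k, Module.Finite K (ℒ k)) (hfd : ∀ k, k ≠ d → ∀ y ∈ ℒ k, f y = 0) :
    hilbertSeries (envelopingGrading ℒ) * (1 - (PowerSeries.X : ℤ⟦X⟧) ^ d) =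
      hilbertSeries (envelopingGrading (characterGrading ℒ f hf)) := by
  have hU := finite_envelopingGrading hℒ.zero_eq_bot hfin
  have hI (k : ℕ) := finite_characterGrading (ℒ := ℒ) (hf := hf) k
  have hV := finite_envelopingGrading
    (isLieGrading_characterKer (hf := hf) hx hℒ hxd hfd).zero_eq_bot hI
  have hQ (k : ℕ) : Module.Finite K
      (if d ≤ k then envelopingGrading ℒ (k - d) else ⊥ : Submodule K W) := by
    by_cases h : d ≤ k
    · rw [if_pos h]
      infer_instance
    · rw [if_neg h]
      infer_instance
  -- The decomposition `U(L) = U(I) ⊕ U(L) x` in degree `k`; the case split matches the coefficients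
  -- of a product with `q ^ d`.
  have hdim (k : ℕ) : Module.finrank K (envelopingGrading ℒ k) =
      Module.finrank K (envelopingGrading (characterGrading ℒ f hf) k) +
        if d ≤ k then Module.finrank K (envelopingGrading ℒ (k - d)) else 0 := by
    rw [← map_extensionMap (hf := hf) hx hxd hℒ hfd k,
      ← (Submodule.equivMapOfInjective _ (extensionMap_injective hx) _).finrank_eq,
      finrank_prod_submodule]
    congr 1
    by_cases h : d ≤ k
    · rw [if_pos h, if_pos h]
    · rw [if_neg h, if_neg h, finrank_bot]
  ext k
  rw [mul_sub, mul_one, map_sub, PowerSeries.coeff_mul_X_pow']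
  simp only [hilbertSeries, PowerSeries.coeff_mk]
  rw [hdim k]
  split_ifs <;> push_cast <;> ring

end Extension

/-! ### The Poincaré–Birkhoff–Witt formula for Hilbert series -/

section PBW

open Filter Topology

universe u v
variable {K : Type u} [Field K]

theorem finrank_envelopingGrading_zero {L : Type v} [LieRing L] [LieAlgebra K L]
    {ℒ : ℕ → Submodule K L} (h0 : ℒ 0 = ⊥) :
    Module.finrank K (envelopingGrading ℒ 0) = 1 := by
  rw [envelopingGrading_zero h0]
  refine finrank_span_singleton fun h => ?_
  have := congrArg (envelopingCounit K L) h
  rw [map_one, map_zero] at this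
  exact one_ne_zero this

theorem envelopingGrading_eq_bot {L : Type v} [LieRing L] [LieAlgebra K L]
    {ℒ : ℕ → Submodule K L} {N : ℕ} (h : ∀ k ≤ N, ℒ k = ⊥) {n : ℕ} (hn : n ≠ 0) (hnN : n ≤ N) :
    envelopingGrading ℒ n = ⊥ := by
  have := envelopingGrading_le (ℒ := ℒ)
    (S := fun k => if k = 0 then ⊤ else if k ≤ N then ⊥ else ⊤) (by simp)
    (fun k l x hx u _ => by
      by_cases hk : k ≤ N
      · rw [h k hk, Submodule.mem_bot] at hx
        simp [hx]
      · simp [show ¬ k + l ≤ N by omega]) n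
  simpa [hn, hnN] using this

/-- A nonzero homogeneous element of minimal degree is detected by a homogeneous linear functional
that vanishes on brackets. -/
theorem exists_character {L : Type v} [LieRing L] [LieAlgebra K L] {ℒ : ℕ → Submodule K L}
    (hℒ : IsLieGrading ℒ) {d : ℕ} (hmin : ∀ k < d, ℒ k = ⊥) {x : L} (hxd : x ∈ ℒ d) (hx : x ≠ 0) :
    ∃ f : L →ₗ[K] K, (∀ y z : L, f ⁅y, z⁆ = 0) ∧ f x = 1 ∧ ∀ k, k ≠ d → ∀ y ∈ ℒ k, f y = 0 := by
  obtain ⟨p, -, hp, hp'⟩ := exists_projections hℒ.isInternal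
  obtain ⟨g, hg⟩ : ∃ g : Module.Dual K L, g x ≠ 0 := by
    by_contra! h
    exact hx ((Module.forall_dual_apply_eq_zero_iff K x).1 h)
  let f : L →ₗ[K] K := (g x)⁻¹ • g ∘ₗ p d
  have hfd : ∀ k, k ≠ d → ∀ y ∈ ℒ k, f y = 0 := by
    intro k hk y hy
    simp [f, hp' k d hk y hy]
  refine ⟨f, fun y z => ?_, ?_, hfd⟩
  · have hy : y ∈ ⨆ k, ℒ k := hℒ.isInternal.submodule_iSup_eq_top ▸ Submodule.mem_top
    have hz : z ∈ ⨆ k, ℒ k := hℒ.isInternal.submodule_iSup_eq_top ▸ Submodule.mem_top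
    induction hy using Submodule.iSup_induction' with
    | zero => simp
    | add a a' _ _ h h' => rw [add_lie, map_add, h, h', add_zero]
    | mem k y hy =>
      induction hz using Submodule.iSup_induction' with
      | zero => simp
      | add b b' _ _ h h' => rw [lie_add, map_add, h, h', add_zero]
      | mem l z hz =>
        -- Minimality of `d` makes all brackets of degree `d` zero: one factor has degree zero or
        -- the other has degree below `d`.
        by_cases hkl : k + l = d
        · rcases Nat.eq_zero_or_pos l with rfl | hl
          · rw [hℒ.zero_eq_bot, Submodule.mem_bot] at hz
            rw [hz, lie_zero, map_zero]
          · rw [hmin k (by omega), Submodule.mem_bot] at hy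
            rw [hy, zero_lie, map_zero]
        · exact hfd _ hkl _ (hℒ.lie_mem k l y z hy hz)
  · simp [f, hp d x hxd, hg]

/-- Induction on the total dimension of `L` in degrees `1, …, N`, with `L` varying. Passing to the
kernel of a character lowers one dimension by one and removes one factor `1 - q ^ d`. When the total
is zero, `U(L)` is `K` up to degree `N`. -/
theorem coeff_hilbertSeries_mul_prod (N : ℕ) {L : Type v} [LieRing L] [LieAlgebra K L]
    {ℒ : ℕ → Submodule K L} (hℒ : IsLieGrading ℒ) (hfin : ∀ k, Module.Finite K (ℒ k))
    {n : ℕ} (hn : n ≤ N) :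
    PowerSeries.coeff n (hilbertSeries (envelopingGrading ℒ) * ∏ k ∈ Finset.range N,
      (1 - (PowerSeries.X : ℤ⟦X⟧) ^ (k + 1)) ^ Module.finrank K (ℒ (k + 1))) =
        PowerSeries.coeff n 1 := by
  induction hs : ∑ k ∈ Finset.range N, Module.finrank K (ℒ (k + 1)) generalizing L with
  | zero =>
    have h0 (k : ℕ) (hk : k < N) : Module.finrank K (ℒ (k + 1)) = 0 :=
      Finset.sum_eq_zero_iff.1 hs k (Finset.mem_range.2 hk)
    have hbot (k : ℕ) (hk : k ≤ N) : ℒ k = ⊥ := by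
      rcases k with _ | k
      · exact hℒ.zero_eq_bot
      · exact Submodule.finrank_eq_zero.1 (h0 k hk)
    rw [Finset.prod_eq_one fun k hk => by rw [h0 k (Finset.mem_range.1 hk), pow_zero], mul_one,
      hilbertSeries, PowerSeries.coeff_mk, PowerSeries.coeff_one]
    split_ifs with h
    · rw [h, finrank_envelopingGrading_zero hℒ.zero_eq_bot, Nat.cast_one]
    · rw [envelopingGrading_eq_bot hbot h hn, finrank_bot, Nat.cast_zero]
  | succ s ih =>
    have hex : ∃ k, ℒ k ≠ ⊥ := by
      by_contra! h
      rw [Finset.sum_eq_zero fun k _ => by rw [h, finrank_bot]] at hs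
      omega
    classical
    set d := Nat.find hex
    have hmin : ∀ k < d, ℒ k = ⊥ := fun k hk => not_not.1 (Nat.find_min hex hk)
    have hd0 : d ≠ 0 := fun h => by
      have := Nat.find_spec hex
      rw [show Nat.find hex = 0 from h] at this
      exact this hℒ.zero_eq_bot
    have hdN : d ≤ N := by
      by_contra! h
      rw [Finset.sum_eq_zero fun k hk => by
        rw [hmin (k + 1) (by have := Finset.mem_range.1 hk; omega), finrank_bot]] at hs
      omega
    -- The product is indexed from zero, so degree `d` corresponds to the index `c = d - 1`.
    obtain ⟨c, hc⟩ := Nat.exists_eq_succ_of_ne_zero hd0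
    obtain ⟨x, hxd, hx0⟩ := Submodule.exists_mem_ne_zero_of_ne_bot (Nat.find_spec hex)
    obtain ⟨f, hf, hx, hfd⟩ := exists_character hℒ hmin hxd hx0
    have hcN : c ∈ Finset.range N := Finset.mem_range.2 (by omega)
    have hrank : Module.finrank K (ℒ (c + 1)) =
        Module.finrank K (characterGrading ℒ f hf (c + 1)) + 1 := by
      rw [show c + 1 = d from hc.symm, finrank_characterGrading_add_one hx hxd]
    have hrank' (k : ℕ) (hk : k ≠ c) : Module.finrank K (ℒ (k + 1)) =
        Module.finrank K (characterGrading ℒ f hf (k + 1)) :=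
      (finrank_characterGrading_of_ne hfd (by omega)).symm
    have hprod : ∏ k ∈ Finset.range N,
        (1 - (PowerSeries.X : ℤ⟦X⟧) ^ (k + 1)) ^ Module.finrank K (ℒ (k + 1)) =
          (1 - (PowerSeries.X : ℤ⟦X⟧) ^ d) * ∏ k ∈ Finset.range N,
            (1 - (PowerSeries.X : ℤ⟦X⟧) ^ (k + 1)) ^
              Module.finrank K (characterGrading ℒ f hf (k + 1)) := by
      rw [← Finset.mul_prod_erase _ _ hcN, ← Finset.mul_prod_erase _ _ hcN, hrank, pow_succ',
        mul_assoc, hc]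
      congr 2
      exact Finset.prod_congr rfl fun k hk => by rw [hrank' k (Finset.ne_of_mem_erase hk)]
    have hsum : ∑ k ∈ Finset.range N, Module.finrank K (characterGrading ℒ f hf (k + 1)) = s := by
      rw [← Finset.add_sum_erase _ _ hcN, hrank, Finset.sum_congr rfl fun k hk => by
        rw [hrank' k (Finset.ne_of_mem_erase hk)]] at hs
      rw [← Finset.add_sum_erase _ _ hcN]
      omega
    rw [hprod, ← mul_assoc, hilbertSeries_mul_one_sub_X_pow (hf := hf) hx hxd hℒ hfin hfd]
    exact ih (isLieGrading_characterKer hx hℒ hxd hfd)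
      (fun k => have := hfin k; finite_characterGrading k) hsum

/-- The factor with index `k` is `1` modulo `q ^ (k + 1)`, so its difference from `1` has order
tending to infinity, whatever the exponents. -/
theorem multipliable_one_sub_X_pow_pow (a : ℕ → ℕ) :
    Multipliable fun k : ℕ => (1 - (PowerSeries.X : ℤ⟦X⟧) ^ (k + 1)) ^ a k := by
  have h : Tendsto (fun k => ((1 - (PowerSeries.X : ℤ⟦X⟧) ^ (k + 1)) ^ a k - 1).order) atTop
      (𝓝 ⊤) := by
    refine ENat.tendsto_nhds_top_iff_natCast_lt.mpr fun n => eventually_atTop.mpr ⟨n, ?_⟩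
    intro m hm
    have hdvd : (PowerSeries.X : ℤ⟦X⟧) ^ (m + 1) ∣ (1 - PowerSeries.X ^ (m + 1)) ^ a m - 1 := by
      have := sub_dvd_pow_sub_pow (1 - (PowerSeries.X : ℤ⟦X⟧) ^ (m + 1)) 1 (a m)
      rwa [one_pow, sub_sub_cancel_left, neg_dvd] at this
    have hle := PowerSeries.nat_le_order _ (m + 1) (PowerSeries.X_pow_dvd_iff.1 hdvd)
    exact lt_of_lt_of_le (by exact_mod_cast Nat.lt_succ_of_le hm) hle
  simpa using PowerSeries.WithPiTopology.multipliable_one_add_of_tendsto_order_atTop_nhds_top ℤ h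

/-- The Hilbert series of the enveloping algebra of a graded Lie algebra. -/
theorem hilbertSeries_mul_tprod {L : Type v} [LieRing L] [LieAlgebra K L]
    {ℒ : ℕ → Submodule K L} (hℒ : IsLieGrading ℒ) (hfin : ∀ k, Module.Finite K (ℒ k)) :
    hilbertSeries (envelopingGrading ℒ) *
      ∏' k : ℕ, (1 - (PowerSeries.X : ℤ⟦X⟧) ^ (k + 1)) ^ Module.finrank K (ℒ (k + 1)) = 1 := by
  have h := ((multipliable_one_sub_X_pow_pow fun k =>
    Module.finrank K (ℒ (k + 1))).hasProd.tendsto_prod_nat).const_mul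
      (hilbertSeries (envelopingGrading ℒ))
  ext n
  -- The coefficient of `q ^ n` is continuous, and along the partial products it is constant from `N
  -- = n` on.
  refine tendsto_nhds_unique
    (((PowerSeries.WithPiTopology.continuous_coeff ℤ n).tendsto _).comp h) ?_
  refine tendsto_const_nhds.congr' ?_
  filter_upwards [eventually_ge_atTop n] with N hN
  exact (coeff_hilbertSeries_mul_prod N hℒ hfin hN).symm

end PBW

end StronglyFreeLie

end

theorem lemma5 {K : Type*} [Field K] {L : Type*} [LieRing L] [LieAlgebra K L]
    (ℒ : ℕ → Submodule K L) (hℒ : StronglyFreeLie.IsLieGrading ℒ)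
    {m n : ℕ} (d : Fin m → ℕ) (e : Fin n → ℕ) (hd : ∀ i, 1 ≤ d i)
    (x : Fin m → L) (hx : ∀ i, x i ∈ ℒ (d i))
    (hgen : LieSubalgebra.lieSpan K L (Set.range x) = ⊤)
    (α : Fin n → FreeLieAlgebra K (Fin m))
    (hα : ∀ j, α j ∈ StronglyFreeLie.freeLieGrading K d (e j))
    (hrel : (FreeLieAlgebra.lift K x).ker =
      LieSubmodule.lieSpan K (FreeLieAlgebra K (Fin m)) (Set.range α))
    (hfree : StronglyFreeLie.IsLieStronglyFree (StronglyFreeLie.freeLieGrading K d) α) :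
    (∀ k, Module.Finite K (ℒ k)) ∧
    (∀ k, Module.Finite K (StronglyFreeLie.envelopingGrading ℒ k)) ∧
    StronglyFreeLie.hilbertSeries (StronglyFreeLie.envelopingGrading ℒ) *
      (1 - ∑ i, (PowerSeries.X : ℤ⟦X⟧) ^ d i + ∑ j, (PowerSeries.X : ℤ⟦X⟧) ^ e j) = 1 ∧
    Multipliable (fun k : ℕ =>
      (1 - (PowerSeries.X : ℤ⟦X⟧) ^ (k + 1)) ^ Module.finrank K (ℒ (k + 1))) ∧
    StronglyFreeLie.hilbertSeries (StronglyFreeLie.envelopingGrading ℒ) *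
      ∏' k : ℕ, (1 - (PowerSeries.X : ℤ⟦X⟧) ^ (k + 1)) ^ Module.finrank K (ℒ (k + 1)) = 1 := by
  open StronglyFreeLie in
  have hmap := map_freeLieGrading hℒ hx hgen
  have hfinF := finite_freeLieGrading (K := K) hd
  have hfin (k : ℕ) : Module.Finite K (ℒ k) := by
    rw [← hmap k]
    infer_instance
  refine ⟨hfin, finite_envelopingGrading hℒ.zero_eq_bot hfin, ?_,
    multipliable_one_sub_X_pow_pow _, hilbertSeries_mul_tprod hℒ hfin⟩
  -- A relation of degree zero would vanish, contradicting that the `α j` freely generate their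
  -- subalgebra.
  have he (j : Fin n) : 1 ≤ e j := by
    by_contra! h
    have hαj := hα j
    rw [Nat.lt_one_iff.1 h, freeLieGrading_zero hd, Submodule.mem_bot] at hαj
    have hι : FreeAlgebra.ι K j = 0 := by
      refine hfree.2.1 ?_
      rw [FreeAlgebra.lift_ι_apply, map_zero, ← envelopingι_apply, hαj, map_zero]
    exact FreeAlgebra.ι_ne_zero j hι
  have hA := hilbertSeries_free_mul (K := K) hd
  have hC := IsStronglyFree.hilbertSeries_eq (isInternal_envelopingGrading_freeLieGrading d)
    (envelopingGrading_zero (freeLieGrading_zero hd))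
    (finite_envelopingGrading (freeLieGrading_zero hd) hfinF)
    (fun _ _ _ ha _ hb => mul_mem_envelopingGrading ha hb)
    (fun j => ι_mem_envelopingGrading (hα j)) he hfree
  have hCL : hilbertSeries (fun k => (envelopingGrading (freeLieGrading K d) k).map
      (subalgebraQuotientMk (envelopingGrading (freeLieGrading K d)) (Algebra.adjoin K
        (Set.range fun j => envelopingι K (α j)))).toLinearMap) =
      hilbertSeries (envelopingGrading ℒ) := by
    ext k
    simp only [hilbertSeries, PowerSeries.coeff_mk]
    rw [← finrank_map_subalgebraQuotientMk (freeLieAlgebra_lift_surjective hgen) hmap hrel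
      (fun j => ⟨e j - 1, by rw [Nat.sub_add_cancel (he j)]; exact hα j⟩) k]
    rfl
  -- With `D = ∑ q ^ d i` and `R = ∑ q ^ e j`, multiplying `H_A = H_C + R H_C H_A` by `1 - D` and
  -- using `H_A (1 - D) = 1` gives `1 = H_C (1 - D + R)`.
  rw [hCL] at hC
  linear_combination (1 - ∑ i, (PowerSeries.X : ℤ⟦X⟧) ^ d i) * (-hC) + hA -
    (∑ j, (PowerSeries.X : ℤ⟦X⟧) ^ e j) * hilbertSeries (envelopingGrading ℒ) * hA
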